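/- Work in Euclidean space of complex dimension $D$ in dimensional regularization, with $[{\rm d}^Dk]={\rm d}^Dk/(2\pi)^D$, an external momentum $p$ with $p^2>0$, and complex indices. Let $$J(D,p,\alpha,\beta)=\int\frac{[{\rm d}^Dk]}{k^{2\alpha}(p-k)^{2\beta}}=\frac{(p^2)^{D/2-\alpha-\beta}}{(4\pi)^{D/2}}\,G(D,\alpha,\beta)$$ be the massless one-loop propagator-type integral and $$J(D,p,\alpha_1,1,1,\alpha_4,1)=\int\frac{[{\rm d}^Dk]\,[{\rm d}^Dq]}{(k-p)^{2\alpha_1}(q-p)^{2}\,q^{2}\,k^{2\alpha_4}(k-q)^{2}}=\frac{(p^2)^{D-\alpha_1-\alpha_4-3}}{(4\pi)^{D}}\,G(D,\alpha_1,1,1,\alpha_4,1)$$ the massless two-loop propagator-type integral in which three adjacent lines (a triangle) have index $1$. Outside their domains of absolute convergence the integrals are defined by meromorphic continuation in the dimension and the indices, that is, in $(D,\alpha,\beta)$ and in $(D,\alpha_1,\alpha_4)$ respectively. Then for arbitrary complex $D,\alpha_1,\alpha_4$ with $D\neq\alpha_1+\alpha_4+2$ which avoid the poles of the one-loop functions on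 the right-hand side below, i.e. such that $D\notin2\mathbb Z$ and, for all $n=0,1,2,\dots$ and $i=1,4$, $\alpha_i\neq D/2-1+n$, $\alpha_i\neq D-2+n$, $\alpha_1+\alpha_4\neq D/2-1-n$ and $\alpha_1+\alpha_4\neq D-3-n$, all the functions involved are regular, the displayed dependence of $J(D,p,\alpha_1,1,1,\alpha_4,1)$ on $p$ holds, and $$G(D,\alpha_1,1,1,\alpha_4,1)=\frac{G(D,1,1)}{D-\alpha_1-\alpha_4-2}\Big[\alpha_1G(D,1+\alpha_1,\alpha_4)-\alpha_1G\big(D,1+\alpha_1,2+\alpha_4-\tfrac D2\big)+\alpha_4G(D,\alpha_1,1+\alpha_4)-\alpha_4G\big(D,2+\alpha_1-\tfrac D2,1+\alpha_4\big)\Big].$$ -/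

import Mathlib

open MeasureTheory

noncomputable section

namespace DimReg

/-! ### Integration in a Euclidean space of complex dimension `D` -/

/-- The area `2 π ^ (D / 2) / Γ (D / 2)` of the unit sphere in dimension `D`. -/
def sphereArea (D : ℂ) : ℂ :=
  2 * (Real.pi : ℂ) ^ (D / 2) / Complex.Gamma (D / 2)

/-- The scalar propagator `1 / k ^ (2 α)` of a line with momentum `k` and index `α`. -/
def line {n : ℕ} (α : ℂ) (k : EuclideanSpace ℝ (Fin n)) : ℂ :=
  1 / ((‖k‖ ^ 2 : ℝ) : ℂ) ^ α

/-- The density which represents `d^D k`, up to the factor `sphereArea (D - 1)`, on functions of a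
loop momentum `k` that are invariant under the rotations which fix the external momentum: `k` is
brought to the form `(k₀, s)`, where `k₀` is the component along the external momentum, and
`s > 0` is the length of the transverse part, which lives in dimension `D - 1`. -/
def oneLoopDensity (D : ℂ) (F : EuclideanSpace ℝ (Fin 2) → ℂ) (x : ℝ × ℝ) : ℂ :=
  (x.2 : ℂ) ^ (D - 2) * F !₂[x.1, x.2]

/-- The region `s > 0`. -/
def oneLoopRegion : Set (ℝ × ℝ) := {x | 0 < x.2}

/-- `∫ [d^D k] F k`, where `[d^D k] = d^D k / (2 π) ^ D`. -/
def oneLoopInt (D : ℂ) (F : EuclideanSpace ℝ (Fin 2) → ℂ) : ℂ :=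
  sphereArea (D - 1) / ((2 * Real.pi : ℝ) : ℂ) ^ D *
    ∫ x in oneLoopRegion, oneLoopDensity D F x

/-- The density which represents `d^D k d^D q`, up to the factor
`sphereArea (D - 1) * sphereArea (D - 2)`, on functions of the loop momenta `k, q` that are
invariant under the rotations which fix the external momentum. By a rotation the external momentum
becomes `(p, 0, 0)`, and `q` becomes `(q₀, s, 0)` with `s > 0` the length of a vector in dimension
`D - 1`, and `k` becomes `(k₀, k₁, r)` with `r > 0` the length of a vector in dimension `D - 2`.
The point `x` is `(q₀, s, k₀, k₁, r)`. -/
def twoLoopDensity (D : ℂ)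
    (F : EuclideanSpace ℝ (Fin 3) → EuclideanSpace ℝ (Fin 3) → ℂ)
    (x : ℝ × ℝ × ℝ × ℝ × ℝ) : ℂ :=
  (x.2.1 : ℂ) ^ (D - 2) * (x.2.2.2.2 : ℂ) ^ (D - 3) *
    F !₂[x.2.2.1, x.2.2.2.1, x.2.2.2.2] !₂[x.1, x.2.1, 0]

/-- The region `s > 0`, `r > 0`. -/
def twoLoopRegion : Set (ℝ × ℝ × ℝ × ℝ × ℝ) := {x | 0 < x.2.1 ∧ 0 < x.2.2.2.2}

/-- `∫ [d^D k] [d^D q] F k q`. -/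
def twoLoopInt (D : ℂ)
    (F : EuclideanSpace ℝ (Fin 3) → EuclideanSpace ℝ (Fin 3) → ℂ) : ℂ :=
  sphereArea (D - 1) * sphereArea (D - 2) / (((2 * Real.pi : ℝ) : ℂ) ^ D) ^ 2 *
    ∫ x in twoLoopRegion, twoLoopDensity D F x

/-! ### The massless propagator-type diagrams, where the integrals converge -/

/-- `1 / (k ^ (2 α) (p - k) ^ (2 β))`, with external momentum of length `p`. -/
def oneLoopIntegrand (p : ℝ) (α β : ℂ) (k : EuclideanSpace ℝ (Fin 2)) : ℂ :=
  line α k * line β (!₂[p, 0] - k)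

/-- `1 / ((k - p) ^ (2 α₁) (q - p) ^ (2 α₂) q ^ (2 α₃) k ^ (2 α₄) (k - q) ^ (2 α₅))`, with external
momentum of length `p`. -/
def twoLoopIntegrand (p : ℝ) (α₁ α₂ α₃ α₄ α₅ : ℂ) (k q : EuclideanSpace ℝ (Fin 3)) : ℂ :=
  line α₁ (k - !₂[p, 0, 0]) * line α₂ (q - !₂[p, 0, 0]) * line α₃ q * line α₄ k *
    line α₅ (k - q)

/-- The one-loop integral with parameters `x = (D, α, β)`. -/
def convOneLoopJ (p : ℝ) (x : ℂ × ℂ × ℂ) : ℂ :=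
  oneLoopInt x.1 (oneLoopIntegrand p x.2.1 x.2.2)

/-- The parameters `(D, α, β)` for which the one-loop integral converges absolutely. -/
def oneLoopDomain (p : ℝ) : Set (ℂ × ℂ × ℂ) :=
  {x | IntegrableOn (oneLoopDensity x.1 (oneLoopIntegrand p x.2.1 x.2.2)) oneLoopRegion}

/-- The two-loop integral with indices `(α₁, 1, 1, α₄, 1)` and parameters `x = (D, α₁, α₄)`. -/
def convTriangleJ (p : ℝ) (x : ℂ × ℂ × ℂ) : ℂ :=
  twoLoopInt x.1 (twoLoopIntegrand p x.2.1 1 1 x.2.2 1)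

/-- The parameters `(D, α₁, α₄)` for which the two-loop integral with indices `(α₁, 1, 1, α₄, 1)`
converges absolutely. -/
def triangleDomain (p : ℝ) : Set (ℂ × ℂ × ℂ) :=
  {x | IntegrableOn (twoLoopDensity x.1 (twoLoopIntegrand p x.2.1 1 1 x.2.2 1)) twoLoopRegion}

/-! ### Meromorphic continuation in the dimension and the indices -/

/-- The function `f` on `U` has a meromorphic continuation `A / B` to the whole space, with `A` and
`B` entire, which is regular at `z` and has the value `w` there. -/
def HasContinuation {E : Type*} [NormedAddCommGroup E] [NormedSpace ℂ E]
    (U : Set E) (f : E → ℂ) (z : E) (w : ℂ) : Prop :=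
  ∃ A B : E → ℂ, Differentiable ℂ A ∧ Differentiable ℂ B ∧ (∀ x ∈ U, B x * f x = A x) ∧
    B z ≠ 0 ∧ w = A z / B z

/-- The meromorphic continuation of `f` from `U` is regular at `z`. -/
def RegularAt {E : Type*} [NormedAddCommGroup E] [NormedSpace ℂ E]
    (U : Set E) (f : E → ℂ) (z : E) : Prop :=
  ∃ w, HasContinuation U f z w

/-- The value at `z` of the meromorphic continuation of `f` from `U` (zero if it is not regular
at `z`). -/
def continuation {E : Type*} [NormedAddCommGroup E] [NormedSpace ℂ E]
    (U : Set E) (f : E → ℂ) (z : E) : ℂ :=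
  open Classical in if h : RegularAt U f z then h.choose else 0

/-- Continuations from a set with an interior point are unique. -/
theorem HasContinuation.unique {E : Type*} [NormedAddCommGroup E] [NormedSpace ℂ E]
    {U : Set E} {f : E → ℂ} {z : E} {w w' : ℂ} (hU : (interior U).Nonempty)
    (h : HasContinuation U f z w) (h' : HasContinuation U f z w') : w = w' := by
  obtain ⟨A, B, hA, hB, hf, hz, rfl⟩ := h
  obtain ⟨A', B', hA', hB', hf', hz', rfl⟩ := h'
  obtain ⟨x₀, hx₀⟩ := hU
  have hl : Differentiable ℂ (fun t : ℂ => x₀ + t • (z - x₀)) := by fun_prop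
  have hg : Differentiable ℂ (fun t : ℂ => A (x₀ + t • (z - x₀)) * B' (x₀ + t • (z - x₀))
      - A' (x₀ + t • (z - x₀)) * B (x₀ + t • (z - x₀))) :=
    ((hA.comp hl).mul (hB'.comp hl)).sub ((hA'.comp hl).mul (hB.comp hl))
  have hev : ∀ᶠ t in nhds (0 : ℂ), x₀ + t • (z - x₀) ∈ U := by
    have : Filter.Tendsto (fun t : ℂ => x₀ + t • (z - x₀)) (nhds 0) (nhds x₀) := by
      simpa using hl.continuous.tendsto 0
    exact this.eventually (mem_interior_iff_mem_nhds.1 hx₀)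
  have key := AnalyticOnNhd.eq_of_eventuallyEq (z₀ := (0 : ℂ))
    (fun t _ => hg.analyticAt t) (fun t _ => (analyticAt_const (v := (0 : ℂ)) (x := t)))
    (hev.mono fun t ht => by
      simp only [← hf _ ht, ← hf' _ ht]; ring)
  have h1 := congrFun key 1
  simp only [one_smul, add_sub_cancel] at h1
  rw [div_eq_div_iff hz hz']
  exact sub_eq_zero.1 h1

/-! ### The dimensionally regularized diagrams and their coefficient functions -/

/-- The one-loop diagram is regular at `(D, α, β)`, for external momentum of length `p`. -/
def OneLoopRegular (D : ℂ) (p : ℝ) (α β : ℂ) : Prop :=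
  RegularAt (oneLoopDomain p) (convOneLoopJ p) (D, α, β)

/-- The dimensionally regularized one-loop diagram `J (D, p, α, β)`. -/
def oneLoopJ (D : ℂ) (p : ℝ) (α β : ℂ) : ℂ :=
  continuation (oneLoopDomain p) (convOneLoopJ p) (D, α, β)

/-- The coefficient function `G (D, α, β)`, from
`J (D, p, α, β) = (p ^ 2) ^ (D / 2 - α - β) / (4 π) ^ (D / 2) * G (D, α, β)` at `p ^ 2 = 1`. -/
def oneLoopG (D α β : ℂ) : ℂ :=
  ((4 * Real.pi : ℝ) : ℂ) ^ (D / 2) * oneLoopJ D 1 α β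

/-- The two-loop diagram with indices `(α₁, 1, 1, α₄, 1)` is regular at `(D, α₁, α₄)`, for external
momentum of length `p`. -/
def TriangleRegular (D : ℂ) (p : ℝ) (α₁ α₄ : ℂ) : Prop :=
  RegularAt (triangleDomain p) (convTriangleJ p) (D, α₁, α₄)

/-- The dimensionally regularized two-loop diagram `J (D, p, α₁, 1, 1, α₄, 1)`. -/
def triangleJ (D : ℂ) (p : ℝ) (α₁ α₄ : ℂ) : ℂ :=
  continuation (triangleDomain p) (convTriangleJ p) (D, α₁, α₄)

/-- The coefficient function `G (D, α₁, 1, 1, α₄, 1)`, from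
`J (D, p, α₁, 1, 1, α₄, 1) =
  (p ^ 2) ^ (D - α₁ - α₄ - 3) / (4 π) ^ D * G (D, α₁, 1, 1, α₄, 1)` at `p ^ 2 = 1`. -/
def triangleG (D α₁ α₄ : ℂ) : ℂ :=
  ((4 * Real.pi : ℝ) : ℂ) ^ D * triangleJ D 1 α₁ α₄

end DimReg

end

/-! The identity is the triangle rule, obtained by integration by parts in the loop momentum `k`.
Dilate `k` about `q`: the total derivative of `(k - q) F` in `k` integrates to zero. Since `2 (k -
q)·(k - c) = (k - q)² + (k - c)² - (q - c)²` for `c = p` and `c = 0`, differentiating the integrand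
returns a multiple of it, plus terms in which a `k`-line gains one unit of index while a line of
index 1 is cancelled. Cancelling `k - q` leaves a product of two one-loop diagrams. Cancelling `q -
p` or `q` leaves a bubble inserted into the other `k`-line, and the bubble's power of momentum
shifts the index of that line by `2 - D/2`. Collecting the multiples of the original integrand gives
the factor `D - α₁ - α₄ - 2`.

This is carried out for real parameters in `trianglePatch`, where all integrals converge absolutely.
The one-loop values `lintegral_plane_rpow` and `lintegral_space_rpow` come from writing propagators
as integrals of Gaussians. `lintegral_twoLoop_swap` permits integrating out either momentum first.
`integral_euler` replaces the vanishing of boundary terms by the scaling of the measure, and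
`integral_triangleDensity` is the resulting identity.

The passage to complex parameters rests on every integrand being the exponential of an affine
function of the parameters. As `1/Γ` is entire, the real identity can be cleared of denominators and
read as `B * J = A` with `A`, `B` entire. By `mul_integral_expFamily_eq` such a relation spreads
from an open set of real parameters to the whole domain of absolute convergence, so `A / B` is the
meromorphic continuation. The conditions in the theorem say that no Gamma function in a numerator
has a pole and that `D - α₁ - α₄ - 2` does not vanish, that is, `B ≠ 0`. -/

open Filter Topology

noncomputable section

namespace DimReg

/-! ### Integrals which depend exponentially on complex parameters -/

section ExpFamily

variable {X : Type*}

/-- The pairing of three complex parameters with three real exponents. -/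
def pairing (z : ℂ × ℂ × ℂ) (ℓ : ℝ × ℝ × ℝ) : ℂ :=
  z.1 * ℓ.1 + z.2.1 * ℓ.2.1 + z.2.2 * ℓ.2.2

/-- The triple of complex numbers given by a triple of real ones. -/
def ofReals (v : ℝ × ℝ × ℝ) : ℂ × ℂ × ℂ := (v.1, v.2.1, v.2.2)

/-- The real parts of a triple of complex numbers. -/
def reals (z : ℂ × ℂ × ℂ) : ℝ × ℝ × ℝ := (z.1.re, z.2.1.re, z.2.2.re)

/-- The imaginary parts of a triple of complex numbers. -/
def imags (z : ℂ × ℂ × ℂ) : ℝ × ℝ × ℝ := (z.1.im, z.2.1.im, z.2.2.im)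

/-- A family of functions on `X` which depends exponentially on three complex parameters. -/
def expFamily (M : X → ℝ) (L : X → ℝ × ℝ × ℝ) (z : ℂ × ℂ × ℂ) (x : X) : ℂ :=
  Complex.exp (M x + pairing z (L x))

variable {M : X → ℝ} {L : X → ℝ × ℝ × ℝ}

theorem pairing_ofReals (v ℓ : ℝ × ℝ × ℝ) :
    pairing (ofReals v) ℓ = ((v.1 * ℓ.1 + v.2.1 * ℓ.2.1 + v.2.2 * ℓ.2.2 : ℝ) : ℂ) := by
  simp [pairing, ofReals]

theorem pairing_re (z : ℂ × ℂ × ℂ) (ℓ : ℝ × ℝ × ℝ) :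
    (pairing z ℓ).re = z.1.re * ℓ.1 + z.2.1.re * ℓ.2.1 + z.2.2.re * ℓ.2.2 := by
  simp [pairing]

theorem ofReals_reals_add (z : ℂ × ℂ × ℂ) :
    ofReals (reals z) + Complex.I • ofReals (imags z) = z := by
  ext <;> simp only [ofReals, reals, imags, Prod.fst_add, Prod.snd_add, Prod.smul_fst,
    Prod.smul_snd, smul_eq_mul, mul_comm Complex.I, Complex.re_add_im]

theorem norm_expFamily (z : ℂ × ℂ × ℂ) (x : X) :
    ‖expFamily M L z x‖ = Real.exp (M x + (pairing z (L x)).re) := by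
  rw [expFamily, Complex.norm_exp]; simp

theorem expFamily_add_smul (z : ℂ × ℂ × ℂ) (v : ℝ × ℝ × ℝ) (t : ℂ) (x : X) :
    expFamily M L (z + t • ofReals v) x = expFamily M L z x *
      Complex.exp (t * ((v.1 * (L x).1 + v.2.1 * (L x).2.1 + v.2.2 * (L x).2.2 : ℝ) : ℂ)) := by
  rw [← pairing_ofReals, expFamily, expFamily, ← Complex.exp_add]
  congr 1
  simp [pairing]
  ring

/-- Along a real direction the norm is an exponential in `s`, hence at most the sum of its values at
the endpoints. Integrability at both ends of a segment therefore gives a single dominating function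
for the whole segment. -/
theorem norm_expFamily_segment_le (z : ℂ × ℂ × ℂ) (v : ℝ × ℝ × ℝ) {s : ℝ} (h0 : 0 ≤ s)
    (h1 : s ≤ 1) (x : X) : ‖expFamily M L (z + (s : ℂ) • ofReals v) x‖ ≤
      ‖expFamily M L z x‖ + ‖expFamily M L (z + ofReals v) x‖ := by
  have e := expFamily_add_smul (M := M) (L := L) z v 1 x
  rw [one_smul] at e
  rw [expFamily_add_smul, e, norm_mul, norm_mul, Complex.norm_exp, Complex.norm_exp]
  set ℓ := v.1 * (L x).1 + v.2.1 * (L x).2.1 + v.2.2 * (L x).2.2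
  simp only [← Complex.ofReal_mul, one_mul, Complex.ofReal_re]
  have : Real.exp (s * ℓ) ≤ 1 + Real.exp ℓ := by
    rcases le_total 0 ℓ with h | h
    · have : Real.exp (s * ℓ) ≤ Real.exp ℓ := Real.exp_le_exp.2 (by nlinarith)
      linarith
    · have : Real.exp (s * ℓ) ≤ 1 := Real.exp_le_one_iff.2 (by nlinarith)
      linarith [Real.exp_pos ℓ]
  nlinarith [norm_nonneg (expFamily M L z x)]

variable [MeasurableSpace X] {m : Measure X}

/-- The factor `ℓ` produced by differentiating in the parameter is absorbed by moving the exponent a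
little further, to both sides because the sign of `ℓ` varies. -/
theorem abs_mul_exp_le {c ℓ δ s : ℝ} (hδ : 0 < δ) (hs : |s - c| ≤ δ) :
    |ℓ| * Real.exp (s * ℓ) ≤
      δ⁻¹ * (Real.exp ((c + 2 * δ) * ℓ) + Real.exp ((c - 2 * δ) * ℓ)) := by
  have h1 : |ℓ| ≤ δ⁻¹ * Real.exp (δ * |ℓ|) := by
    rw [inv_mul_eq_div, le_div_iff₀ hδ]
    nlinarith [Real.add_one_le_exp (δ * |ℓ|)]
  have h2 : s * ℓ ≤ c * ℓ + δ * |ℓ| := by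
    have : (s - c) * ℓ ≤ δ * |ℓ| :=
      (le_abs_self _).trans (by rw [abs_mul]; gcongr)
    linarith
  have h3 : Real.exp (c * ℓ + 2 * δ * |ℓ|) ≤
      Real.exp ((c + 2 * δ) * ℓ) + Real.exp ((c - 2 * δ) * ℓ) := by
    rcases abs_cases ℓ with ⟨h, -⟩ | ⟨h, -⟩ <;> rw [h]
    · rw [show c * ℓ + 2 * δ * ℓ = (c + 2 * δ) * ℓ by ring]
      linarith [Real.exp_pos ((c - 2 * δ) * ℓ)]
    · rw [show c * ℓ + 2 * δ * -ℓ = (c - 2 * δ) * ℓ by ring]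
      linarith [Real.exp_pos ((c + 2 * δ) * ℓ)]
  calc |ℓ| * Real.exp (s * ℓ)
      ≤ (δ⁻¹ * Real.exp (δ * |ℓ|)) * Real.exp (c * ℓ + δ * |ℓ|) := by gcongr
    _ = δ⁻¹ * Real.exp (c * ℓ + 2 * δ * |ℓ|) := by
        rw [mul_assoc, ← Real.exp_add]; ring_nf
    _ ≤ _ := by gcongr

/-- The norm of the integrand sees only `t.re`, so integrability at real points covers the strip.
Differentiation under the integral is then dominated, on a ball of radius `δ`, by the integrands at
`t₀.re ± 2 * δ`. -/
theorem differentiableOn_integral_mul_cexp {g : X → ℂ} {ℓ : X → ℝ} (hℓ : Measurable ℓ) {a b : ℝ}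
    (hint : ∀ s : ℝ, a < s → s < b → Integrable (fun x => g x * Complex.exp (s * ℓ x)) m) :
    DifferentiableOn ℂ (fun t : ℂ => ∫ x, g x * Complex.exp (t * ℓ x) ∂m)
      {t | a < t.re ∧ t.re < b} := by
  rintro t₀ ⟨ha, hb⟩
  apply DifferentiableAt.differentiableWithinAt
  have hnorm : ∀ (t : ℂ) (x : X), ‖g x * Complex.exp (t * ℓ x)‖ =
      ‖g x‖ * Real.exp (t.re * ℓ x) := fun t x => by
    rw [norm_mul, Complex.norm_exp]; simp
  have hint' : ∀ t : ℂ, a < t.re → t.re < b →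
      Integrable (fun x => g x * Complex.exp (t * ℓ x)) m := fun t h1 h2 => by
    have h := hint t.re h1 h2
    refine h.congr' ?_ (Eventually.of_forall fun x => by rw [hnorm, hnorm]; simp)
    have := h.1.mul (f := fun x => g x * Complex.exp (t.re * ℓ x))
      (g := fun x => Complex.exp ((t - t.re) * ℓ x))
      (by apply Measurable.aestronglyMeasurable; fun_prop)
    refine this.congr (Eventually.of_forall fun x => ?_)
    simp only [Pi.mul_apply]
    rw [mul_assoc, ← Complex.exp_add]; ring_nf
  obtain ⟨δ, hδ, h1, h2⟩ : ∃ δ : ℝ, 0 < δ ∧ a < t₀.re - 2 * δ ∧ t₀.re + 2 * δ < b := by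
    have hmin := lt_min (sub_pos.2 ha) (sub_pos.2 hb)
    refine ⟨min (t₀.re - a) (b - t₀.re) / 3, by linarith, ?_, ?_⟩
    · have := min_le_left (t₀.re - a) (b - t₀.re); linarith
    · have := min_le_right (t₀.re - a) (b - t₀.re); linarith
  have hp := (hint (t₀.re + 2 * δ) (by linarith) h2).norm
  have hm := (hint (t₀.re - 2 * δ) h1 (by linarith)).norm
  simp only [hnorm, Complex.ofReal_re] at hp hm
  refine (hasDerivAt_integral_of_dominated_loc_of_deriv_le (Metric.ball_mem_nhds t₀ hδ)
    (F' := fun t x => g x * Complex.exp (t * ℓ x) * ℓ x)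
    (bound := fun x => δ⁻¹ * (‖g x‖ * Real.exp ((t₀.re + 2 * δ) * ℓ x)
      + ‖g x‖ * Real.exp ((t₀.re - 2 * δ) * ℓ x)))
    ?_ (hint' t₀ ha hb) ?_ ?_ ((hp.add hm).const_mul _) ?_).2.differentiableAt
  · have : ∀ᶠ t : ℂ in 𝓝 t₀, a < t.re ∧ t.re < b :=
      (Complex.continuous_re.continuousAt.eventually (lt_mem_nhds ha)).and
        (Complex.continuous_re.continuousAt.eventually (gt_mem_nhds hb))
    exact this.mono fun t ht => (hint' t ht.1 ht.2).1
  · exact (hint' t₀ ha hb).1.mul (by apply Measurable.aestronglyMeasurable; fun_prop)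
  · refine Eventually.of_forall fun x t ht => ?_
    rw [norm_mul, hnorm, Complex.norm_real, Real.norm_eq_abs]
    have h := abs_mul_exp_le (ℓ := ℓ x) hδ (s := t.re) (c := t₀.re) (by
      rw [← Complex.sub_re]
      exact (Complex.abs_re_le_norm _).trans (by
        rw [← dist_eq_norm]; exact (Metric.mem_ball.1 ht).le))
    calc _ = ‖g x‖ * (|ℓ x| * Real.exp (t.re * ℓ x)) := by ring
      _ ≤ _ := mul_le_mul_of_nonneg_left h (norm_nonneg _)
      _ = _ := by ring
  · refine Eventually.of_forall fun x t _ => ?_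
    have : HasDerivAt (fun t : ℂ => t * (ℓ x : ℂ)) (ℓ x : ℂ) t := by
      simpa using (hasDerivAt_id t).mul_const (ℓ x : ℂ)
    simpa [mul_assoc] using (this.cexp.const_mul (g x))

theorem measurable_expFamily (hM : Measurable M) (hL : Measurable L) (z : ℂ × ℂ × ℂ) :
    Measurable (expFamily M L z) := by
  unfold expFamily pairing
  fun_prop

theorem integrable_expFamily_of_reals_eq (hM : Measurable M) (hL : Measurable L)
    {z w : ℂ × ℂ × ℂ} (h : reals z = reals w) (hz : Integrable (expFamily M L z) m) :
    Integrable (expFamily M L w) m := by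
  refine hz.congr' (measurable_expFamily hM hL w).aestronglyMeasurable
    (Eventually.of_forall fun x => ?_)
  simp only [reals, Prod.mk.injEq] at h
  rw [norm_expFamily, norm_expFamily, pairing_re, pairing_re, h.1, h.2.1, h.2.2]

theorem differentiableOn_integral_expFamily_line (hL : Measurable L)
    {z : ℂ × ℂ × ℂ} {v : ℝ × ℝ × ℝ} {a b : ℝ}
    (hint : ∀ s : ℝ, a < s → s < b → Integrable (expFamily M L (z + (s : ℂ) • ofReals v)) m) :
    DifferentiableOn ℂ (fun t : ℂ => ∫ x, expFamily M L (z + t • ofReals v) x ∂m)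
      {t | a < t.re ∧ t.re < b} := by
  simp only [expFamily_add_smul]
  refine differentiableOn_integral_mul_cexp (by fun_prop) fun s h1 h2 => ?_
  have := hint s h1 h2
  rw [show expFamily M L (z + (s : ℂ) • ofReals v) = _ from
    funext fun x => expFamily_add_smul z v s x] at this
  exact this

theorem isPreconnected_strip (a b : ℝ) : IsPreconnected {t : ℂ | a < t.re ∧ t.re < b} :=
  (((convex_Ioo a b).linear_preimage Complex.reLm)).isPreconnected

theorem isOpen_strip (a b : ℝ) : IsOpen {t : ℂ | a < t.re ∧ t.re < b} :=
  isOpen_Ioo.preimage Complex.continuous_re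

/-- Identity theorem: the zeros on the real segment accumulate at an interior point of the connected
strip. -/
theorem eqOn_zero_strip {h : ℂ → ℂ} {a b a' b' : ℝ}
    (hd : DifferentiableOn ℂ h {t | a < t.re ∧ t.re < b})
    (ha : a ≤ a') (hab : a' < b') (hb : b' ≤ b)
    (h0 : ∀ s : ℝ, a' < s → s < b' → h s = 0) : ∀ t : ℂ, a < t.re → t.re < b → h t = 0 := by
  obtain ⟨c, hc1, hc2⟩ := exists_between hab
  intro t h1 h2
  refine (hd.analyticOnNhd (isOpen_strip a b)).eqOn_zero_of_preconnected_of_frequently_eq_zero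
    (isPreconnected_strip a b) (z₀ := (c : ℂ)) ⟨by simpa using ha.trans_lt hc1,
      by simpa using hc2.trans_le hb⟩ ?_ ⟨h1, h2⟩
  have hT : Tendsto (fun s : ℝ => (s : ℂ)) (𝓝[≠] c) (𝓝[≠] (c : ℂ)) := by
    refine tendsto_nhdsWithin_of_tendsto_nhds_of_eventually_within _
      (Complex.continuous_ofReal.continuousAt.tendsto.mono_left nhdsWithin_le_nhds) ?_
    filter_upwards [self_mem_nhdsWithin] with s hs
    simpa using hs
  refine hT.frequently (Eventually.frequently ?_)
  filter_upwards [nhdsWithin_le_nhds (Ioo_mem_nhds hc1 hc2)] with s hs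
  exact h0 s hs.1 hs.2

theorem exists_segment_mem {V : Set (ℝ × ℝ × ℝ)} (hV : IsOpen V) {a : ℝ × ℝ × ℝ} (ha : a ∈ V)
    (b : ℝ × ℝ × ℝ) : ∃ ε : ℝ, 0 < ε ∧ ε < 1 ∧ ∀ s : ℝ, -ε < s → s < ε → a + s • b ∈ V := by
  have hc : ContinuousAt (fun s : ℝ => a + s • b) 0 := by fun_prop
  obtain ⟨ε, hε, h⟩ := Metric.mem_nhds_iff.1 (hc (by simpa using hV.mem_nhds ha))
  refine ⟨min ε 2⁻¹, by positivity, (min_le_right _ _).trans_lt (by norm_num), fun s h1 h2 => ?_⟩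
  apply h
  rw [Metric.mem_ball, dist_zero_right, Real.norm_eq_abs, abs_lt]
  have := min_le_left ε 2⁻¹
  constructor <;> linarith

/-- A relation between entire functions and an exponentially parametrized integral which holds for
the real parameters in an open set holds wherever the integral converges absolutely. -/
theorem mul_integral_expFamily_eq (hM : Measurable M) (hL : Measurable L)
    {A B : ℂ × ℂ × ℂ → ℂ} (hA : Differentiable ℂ A) (hB : Differentiable ℂ B)
    {V : Set (ℝ × ℝ × ℝ)} (hV : IsOpen V) (hne : V.Nonempty)
    (hint : ∀ v ∈ V, Integrable (expFamily M L (ofReals v)) m)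
    (heq : ∀ v ∈ V, B (ofReals v) * ∫ x, expFamily M L (ofReals v) x ∂m = A (ofReals v))
    {z : ℂ × ℂ × ℂ} (hz : Integrable (expFamily M L z) m) :
    B z * ∫ x, expFamily M L z x ∂m = A z := by
  have hdiff : ∀ {w : ℂ × ℂ × ℂ} {v : ℝ × ℝ × ℝ} {a b : ℝ},
      (∀ s : ℝ, a < s → s < b → Integrable (expFamily M L (w + (s : ℂ) • ofReals v)) m) →
      DifferentiableOn ℂ (fun t : ℂ => B (w + t • ofReals v) *
        (∫ x, expFamily M L (w + t • ofReals v) x ∂m) - A (w + t • ofReals v))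
        {t | a < t.re ∧ t.re < b} := fun {w v a b} h => by
    have hl : Differentiable ℂ (fun t : ℂ => w + t • ofReals v) := by fun_prop
    exact ((hB.comp hl).differentiableOn.mul (differentiableOn_integral_expFamily_line hL h)).sub
      (hA.comp hl).differentiableOn
  have hline : ∀ (u v : ℝ × ℝ × ℝ) (s : ℝ),
      ofReals u + (s : ℂ) • ofReals v = ofReals (u + s • v) := fun u v s => by
    ext <;> simp [ofReals]
  -- On the complex line through `reals w` in direction `imags w`, real parameters stay in `V` near
  -- 0, where the relation is known. The point `w` itself is at parameter `I`, inside the strip.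
  have tube : ∀ w : ℂ × ℂ × ℂ, reals w ∈ V →
      B w * (∫ x, expFamily M L w x ∂m) - A w = 0 := fun w hw => by
    obtain ⟨ε, hε, -, hseg⟩ := exists_segment_mem hV hw (imags w)
    have := eqOn_zero_strip (a := -ε) (b := ε) (a' := -ε) (b' := ε)
      (hdiff (w := ofReals (reals w)) (v := imags w) fun s h1 h2 => by
        rw [hline]; exact hint _ (hseg s h1 h2)) le_rfl (by linarith) le_rfl
      (fun s h1 h2 => by rw [hline, heq _ (hseg s h1 h2), sub_self]) Complex.I (by simpa using hε)
      (by simpa using hε)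
    rwa [ofReals_reals_add] at this
  obtain ⟨a, ha⟩ := hne
  -- Move `z` in a real direction to the point `w` over `a ∈ V`. The integral converges at both ends
  -- of this segment, hence along it. The relation holds near `w` by `tube`, then for all parameters
  -- in `(0, 1)`. As `z` may lie on the boundary of the convergence domain, the endpoint 1 is
  -- reached by dominated convergence.
  set v : ℝ × ℝ × ℝ := reals z - a with hv
  set w : ℂ × ℂ × ℂ := z - ofReals v with hw
  have hwa : reals w = a := by
    ext <;> simp [hw, hv, reals, ofReals]
  have hwz : w + ofReals v = z := by simp [hw]
  have hwi : Integrable (expFamily M L w) m :=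
    integrable_expFamily_of_reals_eq hM hL (by rw [hwa]; simp [reals, ofReals]) (hint a ha)
  have hreal : ∀ s : ℝ, reals (w + (s : ℂ) • ofReals v) = a + s • v := fun s => by
    rw [← hwa]; ext <;> simp [reals, ofReals]
  have hsum : Integrable (fun x => ‖expFamily M L w x‖ + ‖expFamily M L (w + ofReals v) x‖) m := by
    rw [hwz]; exact hwi.norm.add hz.norm
  have hsi : ∀ s : ℝ, 0 < s → s < 1 →
      Integrable (expFamily M L (w + (s : ℂ) • ofReals v)) m := fun s h0 h1 =>
    hsum.mono' (measurable_expFamily hM hL _).aestronglyMeasurable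
      (Eventually.of_forall fun x => norm_expFamily_segment_le w v h0.le h1.le x)
  obtain ⟨ε, hε, hε1, hseg⟩ := exists_segment_mem hV ha v
  have hzero := eqOn_zero_strip (a := 0) (b := 1) (a' := 0) (b' := ε) (hdiff hsi) le_rfl hε hε1.le
    (fun s h1 h2 => tube _ (by rw [hreal]; exact hseg s (by linarith) h2))
  have hlim : Tendsto (fun s : ℝ => B (w + (s : ℂ) • ofReals v) *
        (∫ x, expFamily M L (w + (s : ℂ) • ofReals v) x ∂m) - A (w + (s : ℂ) • ofReals v))
      (𝓝[<] 1) (𝓝 (B z * (∫ x, expFamily M L z x ∂m) - A z)) := by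
    have hl : Tendsto (fun s : ℝ => w + (s : ℂ) • ofReals v) (𝓝[<] 1) (𝓝 z) := by
      have : Continuous (fun s : ℝ => w + (s : ℂ) • ofReals v) := by fun_prop
      have := this.tendsto 1
      simp only [Complex.ofReal_one, one_smul, hwz] at this
      exact this.mono_left nhdsWithin_le_nhds
    refine (((hB.continuous.tendsto z).comp hl).mul ?_).sub ((hA.continuous.tendsto z).comp hl)
    refine tendsto_integral_filter_of_dominated_convergence _
      (Eventually.of_forall fun s => (measurable_expFamily hM hL _).aestronglyMeasurable) ?_ hsum
      (Eventually.of_forall fun x => ?_)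
    · filter_upwards [Ioo_mem_nhdsLT (show (0 : ℝ) < 1 by norm_num)] with s hs
      exact Eventually.of_forall fun x => norm_expFamily_segment_le w v hs.1.le hs.2.le x
    · have : Continuous (fun y : ℂ × ℂ × ℂ => expFamily M L y x) := by
        unfold expFamily pairing; fun_prop
      exact (this.tendsto z).comp hl
  have h0 : Tendsto (fun s : ℝ => B (w + (s : ℂ) • ofReals v) *
        (∫ x, expFamily M L (w + (s : ℂ) • ofReals v) x ∂m) - A (w + (s : ℂ) • ofReals v))
      (𝓝[<] 1) (𝓝 0) := by
    refine tendsto_const_nhds.congr' ?_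
    filter_upwards [Ioo_mem_nhdsLT (show (0 : ℝ) < 1 by norm_num)] with s hs
    exact (hzero s (by simpa using hs.1) (by simpa using hs.2)).symm
  exact sub_eq_zero.1 (tendsto_nhds_unique hlim h0)

/-- Convergence depends only on real parts, so the tube over `V` lies in the domain. This supplies
the interior point needed for uniqueness of continuations. -/
theorem interior_integrable_expFamily_nonempty (hM : Measurable M) (hL : Measurable L)
    {V : Set (ℝ × ℝ × ℝ)} (hV : IsOpen V) (hne : V.Nonempty)
    (hint : ∀ v ∈ V, Integrable (expFamily M L (ofReals v)) m) :
    (interior {z | Integrable (expFamily M L z) m}).Nonempty := by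
  have hc : Continuous reals := by unfold reals; fun_prop
  obtain ⟨a, ha⟩ := hne
  refine ⟨ofReals a, mem_interior.2 ⟨reals ⁻¹' V, fun z hz => ?_, hV.preimage hc, ?_⟩⟩
  · exact integrable_expFamily_of_reals_eq hM hL (by simp [reals, ofReals]) (hint _ hz)
  · simpa [reals, ofReals] using ha

end ExpFamily

/-! ### Feynman's parametrization of a product of two propagators -/

/-- Integrability needs no separate proof: a non-integrable function has Bochner integral 0 by
convention, which `0 < v` excludes. -/
theorem lintegral_ofReal_of_integral_eq {X : Type*} [MeasurableSpace X] {m : Measure X} {f : X → ℝ}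
    {v : ℝ} (hf : 0 ≤ᵐ[m] f) (hv : 0 < v) (h : ∫ x, f x ∂m = v) :
    ∫⁻ x, ENNReal.ofReal (f x) ∂m = ENNReal.ofReal v := by
  rw [← h, ofReal_integral_eq_lintegral_ofReal (.of_integral_ne_zero (by rw [h]; exact hv.ne')) hf]

theorem lintegral_rpow_mul_exp {a c : ℝ} (ha : 0 < a) (hc : 0 < c) :
    ∫⁻ x in Set.Ioi (0 : ℝ), ENNReal.ofReal (x ^ (a - 1) * Real.exp (-(c * x))) =
      ENNReal.ofReal (c ^ (-a) * Real.Gamma a) := by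
  refine lintegral_ofReal_of_integral_eq ?_ (by positivity) ?_
  · filter_upwards [self_mem_ae_restrict measurableSet_Ioi] with x hx
    have : (0 : ℝ) < x := hx
    show 0 ≤ _
    positivity
  · rw [Real.integral_rpow_mul_exp_neg_mul_Ioi ha hc, one_div, Real.inv_rpow hc.le,
      Real.rpow_neg hc.le]

theorem lintegral_Ioi_comp_mul (f : ℝ → ENNReal) {t : ℝ} (ht : 0 < t) :
    ∫⁻ x in Set.Ioi (0 : ℝ), f x = ∫⁻ x in Set.Ioi (0 : ℝ), ENNReal.ofReal t * f (t * x) := by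
  have h := lintegral_image_eq_lintegral_abs_deriv_mul (s := Set.Ioi (0 : ℝ)) (f := fun x => t * x)
    (f' := fun _ => t) measurableSet_Ioi
    (fun x _ => by simpa using ((hasDerivAt_id x).const_mul t).hasDerivWithinAt)
    (mul_right_injective₀ ht.ne').injOn f
  rw [abs_of_pos ht] at h
  rw [← h]
  congr 2
  ext x
  simp only [Set.mem_Ioi, Set.mem_image]
  exact ⟨fun hx => ⟨x / t, by positivity, by field_simp⟩, by rintro ⟨y, hy, rfl⟩; positivity⟩

/-- Expand `Γ(a + b) (1 + y) ^ (-(a + b))` as a Gamma integral in `v` and exchange the order. The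
`y`-integral yields `Γ(a)`, the remaining `v`-integral `Γ(b)`. -/
theorem lintegral_beta {a b : ℝ} (ha : 0 < a) (hb : 0 < b) :
    ∫⁻ y in Set.Ioi (0 : ℝ), ENNReal.ofReal (y ^ (a - 1) * (1 + y) ^ (-(a + b))) =
      ENNReal.ofReal (Real.Gamma a * Real.Gamma b / Real.Gamma (a + b)) := by
  have hab : 0 < Real.Gamma (a + b) := by positivity
  have key : ENNReal.ofReal (Real.Gamma (a + b)) *
      ∫⁻ y in Set.Ioi (0 : ℝ), ENNReal.ofReal (y ^ (a - 1) * (1 + y) ^ (-(a + b))) =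
      ENNReal.ofReal (Real.Gamma a * Real.Gamma b) := by
    calc _ = ∫⁻ y in Set.Ioi (0 : ℝ), ∫⁻ v in Set.Ioi (0 : ℝ), ENNReal.ofReal
            (y ^ (a - 1) * (v ^ (a + b - 1) * Real.exp (-((1 + y) * v)))) := by
          rw [← lintegral_const_mul' _ _ ENNReal.ofReal_ne_top]
          refine setLIntegral_congr_fun measurableSet_Ioi fun y hy => ?_
          have hy : 0 < y := hy
          have : ∀ v, ENNReal.ofReal
            (y ^ (a - 1) * (v ^ (a + b - 1) * Real.exp (-((1 + y) * v)))) =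
            ENNReal.ofReal (y ^ (a - 1)) *
              ENNReal.ofReal (v ^ (a + b - 1) * Real.exp (-((1 + y) * v))) := fun v =>
            ENNReal.ofReal_mul (by positivity)
          simp only [this]
          rw [lintegral_const_mul' _ _ ENNReal.ofReal_ne_top,
            lintegral_rpow_mul_exp (by positivity) (by positivity),
            ← ENNReal.ofReal_mul (by positivity), ← ENNReal.ofReal_mul (by positivity)]
          congr 1
          ring
      _ = ∫⁻ v in Set.Ioi (0 : ℝ), ∫⁻ y in Set.Ioi (0 : ℝ), ENNReal.ofReal
            (y ^ (a - 1) * (v ^ (a + b - 1) * Real.exp (-((1 + y) * v)))) :=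
          lintegral_lintegral_swap (by
            apply Measurable.aemeasurable; unfold Function.uncurry; fun_prop)
      _ = ∫⁻ v in Set.Ioi (0 : ℝ), ENNReal.ofReal (Real.Gamma a) *
            ENNReal.ofReal (v ^ (b - 1) * Real.exp (-(1 * v))) := by
          refine setLIntegral_congr_fun measurableSet_Ioi fun v hv => ?_
          have hv : 0 < v := hv
          have : ∀ y, ENNReal.ofReal
            (y ^ (a - 1) * (v ^ (a + b - 1) * Real.exp (-((1 + y) * v)))) =
            ENNReal.ofReal (v ^ (a + b - 1) * Real.exp (-v)) *
              ENNReal.ofReal (y ^ (a - 1) * Real.exp (-(v * y))) := fun y => by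
            rw [← ENNReal.ofReal_mul (by positivity),
              show -((1 + y) * v) = -v + -(v * y) by ring, Real.exp_add]
            congr 1
            ring
          simp only [this]
          rw [lintegral_const_mul' _ _ ENNReal.ofReal_ne_top,
            lintegral_rpow_mul_exp ha hv,
            ← ENNReal.ofReal_mul (by positivity), ← ENNReal.ofReal_mul (by positivity)]
          congr 1
          rw [show b - 1 = a + b - 1 + -a by ring, Real.rpow_add hv (a + b - 1)]
          ring_nf
      _ = _ := by
          rw [lintegral_const_mul' _ _ ENNReal.ofReal_ne_top, lintegral_rpow_mul_exp hb one_pos,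
            ← ENNReal.ofReal_mul (by positivity), Real.one_rpow, one_mul]
  rw [ENNReal.ofReal_div_of_pos hab, ← key, mul_comm, ENNReal.mul_div_cancel_right]
  · simpa using hab
  · exact ENNReal.ofReal_ne_top

/-- The coefficient function of the massless one-loop diagram at real parameters. -/
def realOneLoopG (D α β : ℝ) : ℝ :=
  Real.Gamma (D / 2 - α) * Real.Gamma (D / 2 - β) * Real.Gamma (α + β - D / 2) /
    (Real.Gamma α * Real.Gamma β * Real.Gamma (D - α - β))

/-- The substitution `u = t y` makes the exponent linear in `t`. The `t`-integral is then a Gamma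
integral giving the power of `P`, and the `y`-integral a beta integral. -/
theorem lintegral_feynman {D α β P : ℝ} (hα : α < D / 2) (hβ : β < D / 2) (hD : D / 2 < α + β)
    (hP : 0 < P) :
    ∫⁻ t in Set.Ioi (0 : ℝ), ∫⁻ u in Set.Ioi (0 : ℝ), ENNReal.ofReal
      (t ^ (α - 1) * u ^ (β - 1) * ((t + u) ^ (-(D / 2)) * Real.exp (-(P * (t * u / (t + u)))))) =
    ENNReal.ofReal (Real.Gamma α * Real.Gamma β * realOneLoopG D α β * P ^ (D / 2 - α - β)) := by
  have hα0 : 0 < α := by linarith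
  have hβ0 : 0 < β := by linarith
  calc _ = ∫⁻ t in Set.Ioi (0 : ℝ), ∫⁻ y in Set.Ioi (0 : ℝ), ENNReal.ofReal
        (t ^ (α + β - D / 2 - 1) * (y ^ (β - 1) * (1 + y) ^ (-(D / 2)) *
          Real.exp (-(P * (y / (1 + y)) * t)))) := by
        refine setLIntegral_congr_fun measurableSet_Ioi fun t ht => ?_
        have ht : 0 < t := ht
        rw [lintegral_Ioi_comp_mul _ ht]
        refine setLIntegral_congr_fun measurableSet_Ioi fun y hy => ?_
        have hy : 0 < y := hy
        rw [← ENNReal.ofReal_mul ht.le]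
        congr 1
        rw [show t + t * y = t * (1 + y) by ring, Real.mul_rpow ht.le hy.le,
          Real.mul_rpow ht.le (show 0 ≤ 1 + y by positivity),
          show -(P * (t * (t * y) / (t * (1 + y)))) = -(P * (y / (1 + y)) * t) by field_simp,
          show α + β - D / 2 - 1 = 1 + (α - 1) + (β - 1) + -(D / 2) by ring,
          Real.rpow_add ht, Real.rpow_add ht, Real.rpow_add ht, Real.rpow_one]
        ring
    _ = ∫⁻ y in Set.Ioi (0 : ℝ), ∫⁻ t in Set.Ioi (0 : ℝ), ENNReal.ofReal
        (t ^ (α + β - D / 2 - 1) * (y ^ (β - 1) * (1 + y) ^ (-(D / 2)) *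
          Real.exp (-(P * (y / (1 + y)) * t)))) :=
        lintegral_lintegral_swap (by
            apply Measurable.aemeasurable; unfold Function.uncurry; fun_prop)
    _ = ∫⁻ y in Set.Ioi (0 : ℝ),
        ENNReal.ofReal (Real.Gamma (α + β - D / 2) * P ^ (D / 2 - α - β)) *
        ENNReal.ofReal (y ^ (D / 2 - α - 1) * (1 + y) ^ (-(D / 2 - α + (D / 2 - β)))) := by
        refine setLIntegral_congr_fun measurableSet_Ioi fun y hy => ?_
        have hy : 0 < y := hy
        have hc : 0 < P * (y / (1 + y)) := by positivity
        have : ∀ t, ENNReal.ofReal (t ^ (α + β - D / 2 - 1) * (y ^ (β - 1) * (1 + y) ^ (-(D / 2)) *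
          Real.exp (-(P * (y / (1 + y)) * t)))) =
            ENNReal.ofReal (y ^ (β - 1) * (1 + y) ^ (-(D / 2))) * ENNReal.ofReal
              (t ^ (α + β - D / 2 - 1) * Real.exp (-(P * (y / (1 + y)) * t))) := fun t => by
          rw [← ENNReal.ofReal_mul (by positivity)]
          congr 1
          ring
        simp only [this]
        rw [lintegral_const_mul' _ _ ENNReal.ofReal_ne_top,
          lintegral_rpow_mul_exp (by linarith) hc,
          ← ENNReal.ofReal_mul (by positivity),
          ← ENNReal.ofReal_mul (mul_nonneg (Real.Gamma_pos_of_pos (by linarith)).le (by positivity))]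
        congr 1
        rw [Real.mul_rpow hP.le (by positivity), Real.div_rpow hy.le (by positivity),
          show -(α + β - D / 2) = D / 2 - α - β by ring,
          show D / 2 - α - 1 = β - 1 + (D / 2 - α - β) by ring, Real.rpow_add hy,
          show -(D / 2 - α + (D / 2 - β)) = -(D / 2) - (D / 2 - α - β) by ring,
          Real.rpow_sub (show 0 < 1 + y by positivity) (-(D / 2))]
        ring
    _ = _ := by
        rw [lintegral_const_mul' _ _ ENNReal.ofReal_ne_top,
          lintegral_beta (by linarith) (by linarith),
          ← ENNReal.ofReal_mul (mul_nonneg (Real.Gamma_pos_of_pos (by linarith)).le (by positivity)),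
          realOneLoopG, show D / 2 - α + (D / 2 - β) = D - α - β by ring]
        congr 1
        have h1 : Real.Gamma α ≠ 0 := by positivity
        have h2 : Real.Gamma β ≠ 0 := by positivity
        have h3 : Real.Gamma (D - α - β) ≠ 0 := (Real.Gamma_pos_of_pos (by linarith)).ne'
        field_simp

/-- A product of two propagators is integrated by means of the integrals of Gaussians. -/
theorem lintegral_rpow_mul_rpow {Q : Type*} [MeasurableSpace Q] {ν : Measure Q} [SFinite ν]
    {w a b : Q → ℝ} (hw : Measurable w) (ha : Measurable a) (hb : Measurable b)
    (hpos : ∀ᵐ q ∂ν, 0 ≤ w q ∧ 0 < a q ∧ 0 < b q) {C D α β P : ℝ} (hC : 0 ≤ C)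
    (hgauss : ∀ t u : ℝ, 0 < t → 0 < u →
      ∫⁻ q, ENNReal.ofReal (w q * Real.exp (-(t * a q + u * b q))) ∂ν =
        ENNReal.ofReal (C * ((t + u) ^ (-(D / 2)) * Real.exp (-(P * (t * u / (t + u)))))))
    (hα : α < D / 2) (hβ : β < D / 2) (hD : D / 2 < α + β) (hP : 0 < P) :
    ∫⁻ q, ENNReal.ofReal (w q * (a q ^ (-α) * b q ^ (-β))) ∂ν =
      ENNReal.ofReal (C * realOneLoopG D α β * P ^ (D / 2 - α - β)) := by
  have hα0 : 0 < α := by linarith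
  have hβ0 : 0 < β := by linarith
  have hG : 0 < Real.Gamma α * Real.Gamma β := by positivity
  have key : ENNReal.ofReal (Real.Gamma α * Real.Gamma β) *
      ∫⁻ q, ENNReal.ofReal (w q * (a q ^ (-α) * b q ^ (-β))) ∂ν = ENNReal.ofReal
        (C * (Real.Gamma α * Real.Gamma β * realOneLoopG D α β * P ^ (D / 2 - α - β))) := by
    -- Schwinger parameters: `Γ(α) a ^ (-α)` is the integral of `t ^ (α - 1) exp (-(a t))`. All
    -- integrands are nonnegative, so Tonelli moves the momentum integral inside, where it is
    -- Gaussian.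
    calc _ = ∫⁻ q, (∫⁻ t in Set.Ioi (0 : ℝ), ∫⁻ u in Set.Ioi (0 : ℝ), ENNReal.ofReal
            (t ^ (α - 1) * u ^ (β - 1)) *
            ENNReal.ofReal (w q * Real.exp (-(t * a q + u * b q)))) ∂ν := by
          rw [← lintegral_const_mul' _ _ ENNReal.ofReal_ne_top]
          refine lintegral_congr_ae ?_
          filter_upwards [hpos] with q hq
          obtain ⟨h0, h1, h2⟩ := hq
          have e : ∀ t ∈ Set.Ioi (0 : ℝ), ∀ u ∈ Set.Ioi (0 : ℝ), ENNReal.ofReal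
            (t ^ (α - 1) * u ^ (β - 1)) *
            ENNReal.ofReal (w q * Real.exp (-(t * a q + u * b q))) =
            ENNReal.ofReal (w q) * (ENNReal.ofReal (t ^ (α - 1) * Real.exp (-(a q * t))) *
              ENNReal.ofReal (u ^ (β - 1) * Real.exp (-(b q * u)))) := fun t ht u hu => by
            have ht : 0 < t := ht
            have hu : 0 < u := hu
            rw [← ENNReal.ofReal_mul (by positivity), ← ENNReal.ofReal_mul (by positivity),
              ← ENNReal.ofReal_mul (by positivity), neg_add, Real.exp_add]
            congr 1
            ring_nf
          rw [setLIntegral_congr_fun measurableSet_Ioi fun t ht =>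
            setLIntegral_congr_fun measurableSet_Ioi (e t ht)]
          simp only [lintegral_const_mul' _ _ ENNReal.ofReal_ne_top,
            lintegral_rpow_mul_exp hβ0 h2]
          rw [lintegral_mul_const' _ _ ENNReal.ofReal_ne_top, lintegral_rpow_mul_exp hα0 h1,
            ← ENNReal.ofReal_mul (by positivity), ← ENNReal.ofReal_mul (by positivity),
            ← ENNReal.ofReal_mul (by positivity)]
          congr 1
          ring
      _ = ∫⁻ t in Set.Ioi (0 : ℝ), ∫⁻ q, (∫⁻ u in Set.Ioi (0 : ℝ), ENNReal.ofReal
            (t ^ (α - 1) * u ^ (β - 1)) *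
            ENNReal.ofReal (w q * Real.exp (-(t * a q + u * b q)))) ∂ν := by
          refine lintegral_lintegral_swap (Measurable.aemeasurable ?_)
          exact Measurable.lintegral_prod_right' (f := fun x : (Q × ℝ) × ℝ => ENNReal.ofReal
            (x.1.2 ^ (α - 1) * x.2 ^ (β - 1)) *
            ENNReal.ofReal (w x.1.1 * Real.exp (-(x.1.2 * a x.1.1 + x.2 * b x.1.1)))) (by fun_prop)
      _ = ∫⁻ t in Set.Ioi (0 : ℝ), ∫⁻ u in Set.Ioi (0 : ℝ), ∫⁻ q, ENNReal.ofReal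
            (t ^ (α - 1) * u ^ (β - 1)) *
            ENNReal.ofReal (w q * Real.exp (-(t * a q + u * b q))) ∂ν := by
          refine lintegral_congr fun t => lintegral_lintegral_swap (Measurable.aemeasurable ?_)
          unfold Function.uncurry
          fun_prop
      _ = ∫⁻ t in Set.Ioi (0 : ℝ), ∫⁻ u in Set.Ioi (0 : ℝ), ENNReal.ofReal C * ENNReal.ofReal
            (t ^ (α - 1) * u ^ (β - 1) * ((t + u) ^ (-(D / 2)) *
              Real.exp (-(P * (t * u / (t + u)))))) := by
          refine setLIntegral_congr_fun measurableSet_Ioi fun t ht =>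
            setLIntegral_congr_fun measurableSet_Ioi fun u hu => ?_
          have ht : 0 < t := ht
          have hu : 0 < u := hu
          rw [lintegral_const_mul' _ _ ENNReal.ofReal_ne_top, hgauss t u ht hu,
            ← ENNReal.ofReal_mul (by positivity), ← ENNReal.ofReal_mul hC]
          congr 1
          ring
      _ = _ := by
          simp only [lintegral_const_mul' _ _ ENNReal.ofReal_ne_top]
          rw [lintegral_feynman hα hβ hD hP, ← ENNReal.ofReal_mul hC]
  rw [show C * (Real.Gamma α * Real.Gamma β * realOneLoopG D α β * P ^ (D / 2 - α - β)) =
    Real.Gamma α * Real.Gamma β * (C * realOneLoopG D α β * P ^ (D / 2 - α - β)) by ring,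
    ENNReal.ofReal_mul hG.le] at key
  exact (ENNReal.mul_right_inj (by simpa using hG) ENNReal.ofReal_ne_top).1 key

/-! ### Gaussian integrals and the one-loop integrals at real parameters -/

/-- Complete the square at the weighted mean `(t a + u b) / (t + u)`. -/
theorem lintegral_gaussian_pair (a b : ℝ) {t u : ℝ} (ht : 0 < t) (hu : 0 < u) :
    ∫⁻ x : ℝ, ENNReal.ofReal (Real.exp (-(t * (x - a) ^ 2 + u * (x - b) ^ 2))) =
      ENNReal.ofReal (√Real.pi * ((t + u) ^ (-(1 / 2) : ℝ) *
        Real.exp (-((a - b) ^ 2 * (t * u / (t + u)))))) := by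
  have htu : 0 < t + u := by positivity
  refine lintegral_ofReal_of_integral_eq (Eventually.of_forall fun x => (Real.exp_pos _).le)
    (by positivity) ?_
  have h : ∀ x : ℝ, Real.exp (-(t * (x - a) ^ 2 + u * (x - b) ^ 2)) =
      Real.exp (-((a - b) ^ 2 * (t * u / (t + u)))) *
        Real.exp (-(t + u) * (x - (t * a + u * b) / (t + u)) ^ 2) := fun x => by
    rw [← Real.exp_add]
    congr 1
    field_simp
    ring
  simp only [h]
  rw [integral_const_mul,
    integral_sub_right_eq_self (fun x : ℝ => Real.exp (-(t + u) * x ^ 2)), integral_gaussian,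
    Real.sqrt_div Real.pi_pos.le, Real.rpow_neg htu.le, ← Real.sqrt_eq_rpow]
  ring

theorem lintegral_rpow_mul_gaussian {e c : ℝ} (he : -1 < e) (hc : 0 < c) :
    ∫⁻ s in Set.Ioi (0 : ℝ), ENNReal.ofReal (s ^ e * Real.exp (-(c * s ^ 2))) =
      ENNReal.ofReal (Real.Gamma ((e + 1) / 2) / 2 * c ^ (-((e + 1) / 2))) := by
  have hG : 0 < Real.Gamma ((e + 1) / 2) := Real.Gamma_pos_of_pos (by linarith)
  refine lintegral_ofReal_of_integral_eq ?_ (by positivity) ?_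
  · filter_upwards [self_mem_ae_restrict measurableSet_Ioi] with x hx
    have : (0 : ℝ) < x := hx
    show 0 ≤ _
    positivity
  · have := integral_rpow_mul_exp_neg_mul_rpow (p := 2) two_pos he hc
    simp only [Real.rpow_two, neg_mul] at this
    rw [this, neg_div]
    ring

/-! ### Loop regions as product measures and their Gaussian integrals -/

/-- The half-space which carries a loop momentum with two resolved components. -/
def halfSpace : Set (ℝ × ℝ × ℝ) := {x | 0 < x.2.2}

theorem volume_restrict_oneLoopRegion : (volume : Measure (ℝ × ℝ)).restrict oneLoopRegion =
    (volume : Measure ℝ).prod ((volume : Measure ℝ).restrict (Set.Ioi 0)) := by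
  have h := Measure.prod_restrict (μ := (volume : Measure ℝ)) (ν := (volume : Measure ℝ))
    Set.univ (Set.Ioi 0)
  rw [Measure.restrict_univ] at h
  rw [h, Measure.volume_eq_prod]
  congr 1
  ext x
  simp [oneLoopRegion]

theorem volume_restrict_halfSpace : (volume : Measure (ℝ × ℝ × ℝ)).restrict halfSpace =
    (volume : Measure ℝ).prod ((volume : Measure (ℝ × ℝ)).restrict oneLoopRegion) := by
  have h := Measure.prod_restrict (μ := (volume : Measure ℝ)) (ν := (volume : Measure (ℝ × ℝ)))
    Set.univ oneLoopRegion
  rw [Measure.restrict_univ] at h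
  rw [h, Measure.volume_eq_prod]
  congr 1
  ext x
  simp [oneLoopRegion, halfSpace]

theorem measurableSet_oneLoopRegion : MeasurableSet oneLoopRegion :=
  measurableSet_lt measurable_const measurable_snd

theorem measurableSet_halfSpace : MeasurableSet halfSpace :=
  measurableSet_lt measurable_const measurable_snd.snd

/-- The total Gaussian weight of a loop momentum with one resolved component. -/
def planeConst (D : ℝ) : ℝ := √Real.pi * (Real.Gamma ((D - 1) / 2) / 2)

/-- The total Gaussian weight of a loop momentum with two resolved components. -/
def spaceConst (D : ℝ) : ℝ := Real.pi * (Real.Gamma ((D - 2) / 2) / 2)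

theorem planeConst_pos {D : ℝ} (hD : 1 < D) : 0 < planeConst D := by
  have : 0 < Real.Gamma ((D - 1) / 2) := Real.Gamma_pos_of_pos (by linarith)
  unfold planeConst
  positivity

theorem spaceConst_pos {D : ℝ} (hD : 2 < D) : 0 < spaceConst D := by
  have : 0 < Real.Gamma ((D - 2) / 2) := Real.Gamma_pos_of_pos (by linarith)
  unfold spaceConst
  positivity

/-- The resolved component contributes `(t + u) ^ (-1/2)` and the transverse length, with density `s
^ (D - 2)`, contributes `(t + u) ^ (-(D - 1)/2)`. Together they behave as a Gaussian in dimension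
`D`, for any real `D > 1`. -/
theorem lintegral_plane_gaussian {D : ℝ} (hD : 1 < D) (a b : ℝ) {t u : ℝ} (ht : 0 < t)
    (hu : 0 < u) :
    ∫⁻ x in oneLoopRegion, ENNReal.ofReal (x.2 ^ (D - 2) * Real.exp (-(t * ((x.1 - a) ^ 2 + x.2 ^ 2)
      + u * ((x.1 - b) ^ 2 + x.2 ^ 2)))) = ENNReal.ofReal (planeConst D *
        ((t + u) ^ (-(D / 2)) * Real.exp (-((a - b) ^ 2 * (t * u / (t + u)))))) := by
  have htu : 0 < t + u := by positivity
  have h : ∀ x : ℝ × ℝ, ENNReal.ofReal (x.2 ^ (D - 2) *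
      Real.exp (-(t * ((x.1 - a) ^ 2 + x.2 ^ 2) + u * ((x.1 - b) ^ 2 + x.2 ^ 2)))) =
      ENNReal.ofReal (Real.exp (-(t * (x.1 - a) ^ 2 + u * (x.1 - b) ^ 2))) *
        ENNReal.ofReal (x.2 ^ (D - 2) * Real.exp (-((t + u) * x.2 ^ 2))) := fun x => by
    rw [← ENNReal.ofReal_mul (by positivity), show -(t * ((x.1 - a) ^ 2 + x.2 ^ 2)
      + u * ((x.1 - b) ^ 2 + x.2 ^ 2)) = -(t * (x.1 - a) ^ 2 + u * (x.1 - b) ^ 2) +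
        -((t + u) * x.2 ^ 2) by ring, Real.exp_add]
    congr 1
    ring
  simp only [h]
  rw [volume_restrict_oneLoopRegion, lintegral_prod_mul
    (f := fun x : ℝ => ENNReal.ofReal (Real.exp (-(t * (x - a) ^ 2 + u * (x - b) ^ 2))))
    (g := fun s : ℝ => ENNReal.ofReal (s ^ (D - 2) * Real.exp (-((t + u) * s ^ 2))))
    (by fun_prop) (by fun_prop), lintegral_gaussian_pair a b ht hu,
    lintegral_rpow_mul_gaussian (by linarith) htu, ← ENNReal.ofReal_mul (by positivity), planeConst,
    show -(D / 2) = -(1 / 2) + -((D - 2 + 1) / 2) by ring, Real.rpow_add htu]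
  congr 1
  ring_nf

/-- Splitting off one Cartesian component leaves the plane integral in dimension `D - 1`. Hence
resolving one component or two changes only the constant. -/
theorem lintegral_space_gaussian {D : ℝ} (hD : 2 < D) (a b : ℝ × ℝ) {t u : ℝ} (ht : 0 < t)
    (hu : 0 < u) :
    ∫⁻ x in halfSpace, ENNReal.ofReal (x.2.2 ^ (D - 3) *
      Real.exp (-(t * ((x.1 - a.1) ^ 2 + (x.2.1 - a.2) ^ 2 + x.2.2 ^ 2)
        + u * ((x.1 - b.1) ^ 2 + (x.2.1 - b.2) ^ 2 + x.2.2 ^ 2)))) =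
      ENNReal.ofReal (spaceConst D * ((t + u) ^ (-(D / 2)) *
        Real.exp (-(((a.1 - b.1) ^ 2 + (a.2 - b.2) ^ 2) * (t * u / (t + u)))))) := by
  have htu : 0 < t + u := by positivity
  have h : ∀ x : ℝ × ℝ × ℝ, ENNReal.ofReal (x.2.2 ^ (D - 3) *
      Real.exp (-(t * ((x.1 - a.1) ^ 2 + (x.2.1 - a.2) ^ 2 + x.2.2 ^ 2)
        + u * ((x.1 - b.1) ^ 2 + (x.2.1 - b.2) ^ 2 + x.2.2 ^ 2)))) =
      ENNReal.ofReal (Real.exp (-(t * (x.1 - a.1) ^ 2 + u * (x.1 - b.1) ^ 2))) *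
        ENNReal.ofReal (x.2.2 ^ (D - 1 - 2) * Real.exp (-(t * ((x.2.1 - a.2) ^ 2 + x.2.2 ^ 2)
        + u * ((x.2.1 - b.2) ^ 2 + x.2.2 ^ 2)))) := fun x => by
    rw [← ENNReal.ofReal_mul (by positivity),
      show -(t * ((x.1 - a.1) ^ 2 + (x.2.1 - a.2) ^ 2 + x.2.2 ^ 2)
        + u * ((x.1 - b.1) ^ 2 + (x.2.1 - b.2) ^ 2 + x.2.2 ^ 2)) =
        -(t * (x.1 - a.1) ^ 2 + u * (x.1 - b.1) ^ 2) +
        -(t * ((x.2.1 - a.2) ^ 2 + x.2.2 ^ 2) + u * ((x.2.1 - b.2) ^ 2 + x.2.2 ^ 2)) by ring,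
      Real.exp_add, show D - 1 - 2 = D - 3 by ring]
    congr 1
    ring
  simp only [h]
  rw [volume_restrict_halfSpace, lintegral_prod_mul
    (f := fun x : ℝ => ENNReal.ofReal (Real.exp (-(t * (x - a.1) ^ 2 + u * (x - b.1) ^ 2))))
    (g := fun x : ℝ × ℝ => ENNReal.ofReal (x.2 ^ (D - 1 - 2) *
      Real.exp (-(t * ((x.1 - a.2) ^ 2 + x.2 ^ 2) + u * ((x.1 - b.2) ^ 2 + x.2 ^ 2)))))
    (by fun_prop) (by fun_prop), lintegral_gaussian_pair _ _ ht hu,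
    lintegral_plane_gaussian (by linarith) _ _ ht hu, ← ENNReal.ofReal_mul (by positivity),
    planeConst, spaceConst, add_mul ((a.1 - b.1) ^ 2), neg_add, Real.exp_add,
    show -(D / 2) = -(1 / 2) + -((D - 1) / 2) by ring, Real.rpow_add htu,
    show D - 1 - 1 = D - 2 by ring]
  congr 1
  linear_combination (Real.Gamma ((D - 2) / 2) / 2 * ((t + u) ^ (-(1 / 2) : ℝ) *
    (t + u) ^ (-((D - 1) / 2)) * (Real.exp (-((a.1 - b.1) ^ 2 * (t * u / (t + u)))) *
      Real.exp (-((a.2 - b.2) ^ 2 * (t * u / (t + u))))))) * Real.mul_self_sqrt Real.pi_pos.le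

/-- The integral of two propagators over a loop momentum with one resolved component. -/
theorem lintegral_plane_rpow {D α β : ℝ} (hD : 1 < D) (hα : α < D / 2) (hβ : β < D / 2)
    (hαβ : D / 2 < α + β) {a b : ℝ} (hab : 0 < (a - b) ^ 2) :
    ∫⁻ x in oneLoopRegion, ENNReal.ofReal (x.2 ^ (D - 2) * (((x.1 - a) ^ 2 + x.2 ^ 2) ^ (-α) *
      ((x.1 - b) ^ 2 + x.2 ^ 2) ^ (-β))) =
      ENNReal.ofReal (planeConst D * realOneLoopG D α β * ((a - b) ^ 2) ^ (D / 2 - α - β)) := by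
  refine lintegral_rpow_mul_rpow (w := fun x : ℝ × ℝ => x.2 ^ (D - 2)) (by fun_prop)
    (a := fun x : ℝ × ℝ => (x.1 - a) ^ 2 + x.2 ^ 2) (by fun_prop)
    (b := fun x : ℝ × ℝ => (x.1 - b) ^ 2 + x.2 ^ 2) (by fun_prop) ?_ (planeConst_pos hD).le
    (fun t u ht hu => lintegral_plane_gaussian hD a b ht hu) hα hβ hαβ hab
  filter_upwards [self_mem_ae_restrict measurableSet_oneLoopRegion] with x hx
  have : 0 < x.2 := hx
  exact ⟨by positivity, by positivity, by positivity⟩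

/-- The integral of two propagators over a loop momentum with two resolved components. -/
theorem lintegral_space_rpow {D α β : ℝ} (hD : 2 < D) (hα : α < D / 2) (hβ : β < D / 2)
    (hαβ : D / 2 < α + β) {a b : ℝ × ℝ} (hab : 0 < (a.1 - b.1) ^ 2 + (a.2 - b.2) ^ 2) :
    ∫⁻ x in halfSpace, ENNReal.ofReal (x.2.2 ^ (D - 3) *
      (((x.1 - a.1) ^ 2 + (x.2.1 - a.2) ^ 2 + x.2.2 ^ 2) ^ (-α) *
        ((x.1 - b.1) ^ 2 + (x.2.1 - b.2) ^ 2 + x.2.2 ^ 2) ^ (-β))) =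
      ENNReal.ofReal (spaceConst D * realOneLoopG D α β *
        ((a.1 - b.1) ^ 2 + (a.2 - b.2) ^ 2) ^ (D / 2 - α - β)) := by
  refine lintegral_rpow_mul_rpow (w := fun x : ℝ × ℝ × ℝ => x.2.2 ^ (D - 3)) (by fun_prop)
    (a := fun x : ℝ × ℝ × ℝ => (x.1 - a.1) ^ 2 + (x.2.1 - a.2) ^ 2 + x.2.2 ^ 2) (by fun_prop)
    (b := fun x : ℝ × ℝ × ℝ => (x.1 - b.1) ^ 2 + (x.2.1 - b.2) ^ 2 + x.2.2 ^ 2) (by fun_prop) ?_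
    (spaceConst_pos hD).le
    (fun t u ht hu => lintegral_space_gaussian hD a b ht hu) hα hβ hαβ hab
  filter_upwards [self_mem_ae_restrict measurableSet_halfSpace] with x hx
  have : 0 < x.2.2 := hx
  exact ⟨by positivity, by positivity, by positivity⟩

/-! ### Two-loop integrals at real parameters -/

theorem measurableSet_twoLoopRegion : MeasurableSet twoLoopRegion :=
  (measurableSet_lt measurable_const measurable_snd.fst).inter
    (measurableSet_lt measurable_const measurable_snd.snd.snd.snd)

theorem volume_restrict_twoLoopRegion :
    (volume : Measure (ℝ × ℝ × ℝ × ℝ × ℝ)).restrict twoLoopRegion =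
      (volume : Measure ℝ).prod (((volume : Measure ℝ).restrict (Set.Ioi 0)).prod
        ((volume : Measure (ℝ × ℝ × ℝ)).restrict halfSpace)) := by
  have h := Measure.prod_restrict (μ := (volume : Measure ℝ))
    (ν := (volume : Measure (ℝ × ℝ × ℝ × ℝ))) Set.univ (Set.Ioi 0 ×ˢ halfSpace)
  rw [Measure.restrict_univ] at h
  rw [Measure.prod_restrict, ← Measure.volume_eq_prod, h, Measure.volume_eq_prod]
  congr 1
  ext x
  simp [twoLoopRegion, halfSpace]

theorem lintegral_twoLoopRegion {f : ℝ × ℝ × ℝ × ℝ × ℝ → ENNReal} (hf : Measurable f) :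
    ∫⁻ x in twoLoopRegion, f x =
      ∫⁻ a in oneLoopRegion, ∫⁻ b in halfSpace, f (a.1, a.2, b) := by
  rw [volume_restrict_twoLoopRegion, volume_restrict_oneLoopRegion,
    lintegral_prod _ hf.aemeasurable,
    lintegral_prod _ (Measurable.aemeasurable (Measurable.lintegral_prod_right'
      (f := fun x : (ℝ × ℝ) × (ℝ × ℝ × ℝ) => f (x.1.1, x.1.2, x.2)) (by fun_prop)))]
  refine lintegral_congr fun q => ?_
  rw [lintegral_prod _ (by fun_prop)]

theorem lintegral_oneLoopRegion_polar (g : ℝ × ℝ → ENNReal) (hg : Measurable g) :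
    ∫⁻ y in oneLoopRegion, g y = ∫⁻ κ in Set.Ioi (0 : ℝ), ∫⁻ θ in Set.Ioo 0 Real.pi,
      ENNReal.ofReal κ * g (κ * Real.cos θ, κ * Real.sin θ) := by
  have hm : Measurable (fun p : ℝ × ℝ =>
      ENNReal.ofReal p.1 * g (p.1 * Real.cos p.2, p.1 * Real.sin p.2)) := by fun_prop
  rw [← lintegral_indicator measurableSet_oneLoopRegion, ← lintegral_comp_polarCoord_symm,
    ← lintegral_prod _ hm.aemeasurable, Measure.prod_restrict, ← Measure.volume_eq_prod,
    ← lintegral_indicator polarCoord.open_target.measurableSet,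
    ← lintegral_indicator (measurableSet_Ioi.prod measurableSet_Ioo)]
  refine lintegral_congr fun x => ?_
  obtain ⟨κ, θ⟩ := x
  by_cases h : (κ, θ) ∈ polarCoord.target
  · rw [Set.indicator_of_mem h]
    have hκ : 0 < κ := h.1
    have h1 : -Real.pi < θ := h.2.1
    have h2 : θ < Real.pi := h.2.2
    by_cases hθ : 0 < θ
    · have : 0 < κ * Real.sin θ := mul_pos hκ (Real.sin_pos_of_pos_of_lt_pi hθ h2)
      rw [Set.indicator_of_mem (show (κ, θ) ∈ Set.Ioi 0 ×ˢ Set.Ioo 0 Real.pi from ⟨hκ, hθ, h2⟩),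
        polarCoord_symm_apply, Set.indicator_of_mem (by exact this), smul_eq_mul]
    · have : κ * Real.sin θ ≤ 0 := mul_nonpos_of_nonneg_of_nonpos hκ.le
        (Real.sin_nonpos_of_nonpos_of_neg_pi_le (not_lt.1 hθ) h1.le)
      rw [polarCoord_symm_apply, Set.indicator_of_notMem (show _ ∉ oneLoopRegion from not_lt.2 this),
        smul_zero, Set.indicator_of_notMem (fun h' => hθ h'.2.1)]
  · rw [Set.indicator_of_notMem h, Set.indicator_of_notMem]
    exact fun h' => h ⟨h'.1, (neg_lt_zero.2 Real.pi_pos).trans h'.2.1, h'.2.2⟩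

theorem lintegral_halfSpace_polar (g : ℝ × ℝ × ℝ → ENNReal) (hg : Measurable g) :
    ∫⁻ b in halfSpace, g b = ∫⁻ c in oneLoopRegion, ∫⁻ θ in Set.Ioo 0 Real.pi,
      ENNReal.ofReal c.2 * g (c.1, c.2 * Real.cos θ, c.2 * Real.sin θ) := by
  have hm : Measurable (fun c : ℝ × ℝ => ∫⁻ θ in Set.Ioo 0 Real.pi,
      ENNReal.ofReal c.2 * g (c.1, c.2 * Real.cos θ, c.2 * Real.sin θ)) :=
    Measurable.lintegral_prod_right' (f := fun x : (ℝ × ℝ) × ℝ =>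
      ENNReal.ofReal x.1.2 * g (x.1.1, x.1.2 * Real.cos x.2, x.1.2 * Real.sin x.2)) (by fun_prop)
  rw [volume_restrict_halfSpace, lintegral_prod _ hg.aemeasurable]
  conv_rhs => rw [volume_restrict_oneLoopRegion, lintegral_prod _ hm.aemeasurable]
  exact lintegral_congr fun k => lintegral_oneLoopRegion_polar _ (by fun_prop)

/-- The arguments of `H` are the invariants of the two momenta: components along `p`, transverse
lengths and transverse scalar product. Polar coordinates for the transverse part of `k`, with axis
along that of `q`, bring the Jacobian that turns `D - 3` into `D - 2`, and the density becomes
visibly symmetric in the two momenta. -/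
theorem lintegral_twoLoop_polar (D : ℝ) {H : ℝ × ℝ × ℝ × ℝ × ℝ → ENNReal} (hH : Measurable H) :
    ∫⁻ a in oneLoopRegion, ∫⁻ b in halfSpace, ENNReal.ofReal (a.2 ^ (D - 2) * b.2.2 ^ (D - 3)) *
        H (a.1, b.1, a.2, √(b.2.1 ^ 2 + b.2.2 ^ 2), a.2 * b.2.1) =
      ∫⁻ a in oneLoopRegion, ∫⁻ c in oneLoopRegion, ∫⁻ θ in Set.Ioo 0 Real.pi,
        ENNReal.ofReal (a.2 ^ (D - 2) * c.2 ^ (D - 2) * Real.sin θ ^ (D - 3)) *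
          H (a.1, c.1, a.2, c.2, a.2 * c.2 * Real.cos θ) := by
  refine lintegral_congr fun a => ?_
  rw [lintegral_halfSpace_polar _ (by fun_prop)]
  refine setLIntegral_congr_fun measurableSet_oneLoopRegion fun c hc => ?_
  have hc : 0 < c.2 := hc
  refine setLIntegral_congr_fun measurableSet_Ioo fun θ hθ => ?_
  have hs : 0 < Real.sin θ := Real.sin_pos_of_pos_of_lt_pi hθ.1 hθ.2
  have e1 : (c.2 * Real.cos θ) ^ 2 + (c.2 * Real.sin θ) ^ 2 = c.2 ^ 2 := by
    linear_combination c.2 ^ 2 * Real.cos_sq_add_sin_sq θ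
  simp only [e1]
  rw [Real.sqrt_sq hc.le, ← mul_assoc, ← ENNReal.ofReal_mul hc.le, mul_assoc a.2]
  congr 2
  rw [Real.mul_rpow hc.le hs.le, show D - 2 = 1 + (D - 3) by ring, Real.rpow_add hc 1, Real.rpow_one]
  ring

/-- The invariant measure on pairs of loop momenta is symmetric in the two momenta. -/
theorem lintegral_twoLoop_swap (D : ℝ) {H : ℝ × ℝ × ℝ × ℝ × ℝ → ENNReal} (hH : Measurable H) :
    ∫⁻ a in oneLoopRegion, ∫⁻ b in halfSpace, ENNReal.ofReal (a.2 ^ (D - 2) * b.2.2 ^ (D - 3)) *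
        H (a.1, b.1, a.2, √(b.2.1 ^ 2 + b.2.2 ^ 2), a.2 * b.2.1) =
      ∫⁻ a in oneLoopRegion, ∫⁻ b in halfSpace, ENNReal.ofReal (a.2 ^ (D - 2) * b.2.2 ^ (D - 3)) *
        H (b.1, a.1, √(b.2.1 ^ 2 + b.2.2 ^ 2), a.2, a.2 * b.2.1) := by
  rw [lintegral_twoLoop_polar D hH, lintegral_twoLoop_polar D
    (H := fun y => H (y.2.1, y.1, y.2.2.2.1, y.2.2.1, y.2.2.2.2)) (by fun_prop),
    lintegral_lintegral_swap]
  · refine lintegral_congr fun a => lintegral_congr fun c => lintegral_congr fun θ => ?_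
    rw [mul_comm (c.2 ^ (D - 2)), mul_comm c.2]
  · exact (Measurable.lintegral_prod_right' (f := fun x : ((ℝ × ℝ) × (ℝ × ℝ)) × ℝ =>
      ENNReal.ofReal (x.1.1.2 ^ (D - 2) * x.1.2.2 ^ (D - 2) * Real.sin x.2 ^ (D - 3)) *
          H (x.1.1.1, x.1.2.1, x.1.1.2, x.1.2.2, x.1.1.2 * x.1.2.2 * Real.cos x.2))
      (by fun_prop)).aemeasurable

/-- The weight of a pair of loop momenta. -/
def weight (D : ℝ) (x : ℝ × ℝ × ℝ × ℝ × ℝ) : ℝ := x.2.1 ^ (D - 2) * x.2.2.2.2 ^ (D - 3)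

/-- The square of `q - c`, where `c` is parallel to the external momentum. -/
def qSq (c : ℝ) (x : ℝ × ℝ × ℝ × ℝ × ℝ) : ℝ := (x.1 - c) ^ 2 + x.2.1 ^ 2

/-- The square of `k - c`, where `c` is parallel to the external momentum. -/
def kSq (c : ℝ) (x : ℝ × ℝ × ℝ × ℝ × ℝ) : ℝ :=
  (x.2.2.1 - c) ^ 2 + x.2.2.2.1 ^ 2 + x.2.2.2.2 ^ 2

/-- The square of `k - q`. -/
def kqSq (x : ℝ × ℝ × ℝ × ℝ × ℝ) : ℝ :=
  (x.2.2.1 - x.1) ^ 2 + (x.2.2.2.1 - x.2.1) ^ 2 + x.2.2.2.2 ^ 2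

@[fun_prop]
theorem measurable_weight (D : ℝ) : Measurable (weight D) := by unfold weight; fun_prop

@[fun_prop]
theorem measurable_qSq (c : ℝ) : Measurable (qSq c) := by unfold qSq; fun_prop

@[fun_prop]
theorem measurable_kSq (c : ℝ) : Measurable (kSq c) := by unfold kSq; fun_prop

@[fun_prop]
theorem measurable_kqSq : Measurable kqSq := by unfold kqSq; fun_prop

theorem weight_pos (D : ℝ) {x : ℝ × ℝ × ℝ × ℝ × ℝ} (hx : x ∈ twoLoopRegion) : 0 < weight D x := by
  have h1 := hx.1
  have h2 := hx.2
  unfold weight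
  positivity

theorem qSq_pos (c : ℝ) {x : ℝ × ℝ × ℝ × ℝ × ℝ} (hx : x ∈ twoLoopRegion) : 0 < qSq c x := by
  have h1 := hx.1
  unfold qSq
  positivity

theorem kSq_pos (c : ℝ) {x : ℝ × ℝ × ℝ × ℝ × ℝ} (hx : x ∈ twoLoopRegion) : 0 < kSq c x := by
  have h2 := hx.2
  unfold kSq
  positivity

theorem kqSq_pos {x : ℝ × ℝ × ℝ × ℝ × ℝ} (hx : x ∈ twoLoopRegion) : 0 < kqSq x := by
  have h2 := hx.2
  unfold kqSq
  positivity

/-- The density of the product of two one-loop diagrams. -/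
def productDensity (D c e α β : ℝ) (x : ℝ × ℝ × ℝ × ℝ × ℝ) : ℝ :=
  weight D x * (qSq c x ^ (-1 : ℝ) * qSq e x ^ (-1 : ℝ)) * (kSq c x ^ (-α) * kSq e x ^ (-β))

/-- The density of the two-loop diagram with a one-loop insertion into a line. -/
def nestedDensity (D c e α β : ℝ) (x : ℝ × ℝ × ℝ × ℝ × ℝ) : ℝ :=
  weight D x * (qSq e x ^ (-1 : ℝ) * kqSq x ^ (-1 : ℝ)) * (kSq c x ^ (-α) * kSq e x ^ (-β))

theorem realOneLoopG_pos {D α β : ℝ} (hα : α < D / 2) (hβ : β < D / 2) (hαβ : D / 2 < α + β) :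
    0 < realOneLoopG D α β := by
  have h1 : 0 < Real.Gamma (D / 2 - α) := Real.Gamma_pos_of_pos (by linarith)
  have h2 : 0 < Real.Gamma (D / 2 - β) := Real.Gamma_pos_of_pos (by linarith)
  have h3 : 0 < Real.Gamma (α + β - D / 2) := Real.Gamma_pos_of_pos (by linarith)
  have h4 : 0 < Real.Gamma α := Real.Gamma_pos_of_pos (by linarith)
  have h5 : 0 < Real.Gamma β := Real.Gamma_pos_of_pos (by linarith)
  have h6 : 0 < Real.Gamma (D - α - β) := Real.Gamma_pos_of_pos (by linarith)
  unfold realOneLoopG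
  positivity

theorem realOneLoopG_comm (D α β : ℝ) : realOneLoopG D α β = realOneLoopG D β α := by
  unfold realOneLoopG
  rw [mul_comm (Real.Gamma (D / 2 - α)), mul_comm (Real.Gamma α), add_comm, sub_right_comm D α β]

/-- No propagator joins `k` and `q`, so the integral factorizes. The range `2 < D < 4` is what the
bubble with both indices 1 needs to converge. -/
theorem lintegral_productDensity {D c e α β : ℝ} (hD2 : 2 < D) (hD4 : D < 4) (hα : α < D / 2)
    (hβ : β < D / 2) (hαβ : D / 2 < α + β) (hce : 0 < (c - e) ^ 2) :
    ∫⁻ x in twoLoopRegion, ENNReal.ofReal (productDensity D c e α β x) =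
      ENNReal.ofReal (planeConst D * spaceConst D * ((c - e) ^ 2) ^ (D - α - β - 2) *
        (realOneLoopG D 1 1 * realOneLoopG D α β)) := by
  rw [lintegral_twoLoopRegion (by unfold productDensity; fun_prop)]
  have h := lintegral_space_rpow hD2 hα hβ hαβ (a := (c, 0)) (b := (e, 0)) (by simpa using hce)
  calc _ = ∫⁻ a in oneLoopRegion, ENNReal.ofReal (a.2 ^ (D - 2) *
        (((a.1 - c) ^ 2 + a.2 ^ 2) ^ (-1 : ℝ) * ((a.1 - e) ^ 2 + a.2 ^ 2) ^ (-1 : ℝ))) *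
        ∫⁻ b in halfSpace, ENNReal.ofReal (b.2.2 ^ (D - 3) *
          (((b.1 - c) ^ 2 + (b.2.1 - 0) ^ 2 + b.2.2 ^ 2) ^ (-α) *
            ((b.1 - e) ^ 2 + (b.2.1 - 0) ^ 2 + b.2.2 ^ 2) ^ (-β))) := by
        refine setLIntegral_congr_fun measurableSet_oneLoopRegion fun a ha => ?_
        have ha : 0 < a.2 := ha
        rw [← lintegral_const_mul' _ _ ENNReal.ofReal_ne_top]
        refine lintegral_congr fun b => ?_
        rw [← ENNReal.ofReal_mul (by positivity)]
        congr 1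
        simp only [productDensity, weight, qSq, kSq, sub_zero]
        ring
    _ = _ := by
        rw [h, lintegral_mul_const' _ _ ENNReal.ofReal_ne_top,
          lintegral_plane_rpow (by linarith) (by linarith) (by linarith) (by linarith) hce,
          ← ENNReal.ofReal_mul (mul_nonneg (mul_nonneg (planeConst_pos (by linarith)).le
            (realOneLoopG_pos (by linarith) (by linarith) (by linarith)).le) (by positivity))]
        congr 1
        rw [show D - α - β - 2 = D / 2 - 1 - 1 + (D / 2 - α - β) by ring,
          Real.rpow_add hce (D / 2 - 1 - 1)]
        simp only [sub_self]
        ring_nf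

/-- With `k` fixed, the `q`-integral is a bubble proportional to `((k - e)²) ^ (D/2 - 2)`, which
turns the index `β` into `2 + β - D/2`. The bounds on `β` and `α + β` are the convergence conditions
of the remaining one-loop integral. -/
theorem lintegral_nestedDensity {D c e α β : ℝ} (hD2 : 2 < D) (hD4 : D < 4) (hα : α < D / 2)
    (hβ : β < D - 2) (hαβ : D - 2 < α + β) (hce : 0 < (c - e) ^ 2) :
    ∫⁻ x in twoLoopRegion, ENNReal.ofReal (nestedDensity D c e α β x) =
      ENNReal.ofReal (planeConst D * spaceConst D * ((c - e) ^ 2) ^ (D - α - β - 2) *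
        (realOneLoopG D 1 1 * realOneLoopG D α (2 + β - D / 2))) := by
  rw [lintegral_twoLoopRegion (by unfold nestedDensity; fun_prop)]
  calc _ = ∫⁻ a in oneLoopRegion, ∫⁻ b in halfSpace,
        ENNReal.ofReal (a.2 ^ (D - 2) * b.2.2 ^ (D - 3)) *
        (fun y : ℝ × ℝ × ℝ × ℝ × ℝ => ENNReal.ofReal (((y.1 - e) ^ 2 + y.2.2.1 ^ 2) ^ (-1 : ℝ) *
          ((y.2.1 - y.1) ^ 2 + y.2.2.1 ^ 2 + y.2.2.2.1 ^ 2 - 2 * y.2.2.2.2) ^ (-1 : ℝ) *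
          (((y.2.1 - c) ^ 2 + y.2.2.2.1 ^ 2) ^ (-α) * ((y.2.1 - e) ^ 2 + y.2.2.2.1 ^ 2) ^ (-β))))
        (a.1, b.1, a.2, √(b.2.1 ^ 2 + b.2.2 ^ 2), a.2 * b.2.1) := by
        refine setLIntegral_congr_fun measurableSet_oneLoopRegion fun a ha =>
          setLIntegral_congr_fun measurableSet_halfSpace fun b hb => ?_
        have ha : 0 < a.2 := ha
        have hb : 0 < b.2.2 := hb
        simp only
        rw [Real.sq_sqrt (by positivity), ← ENNReal.ofReal_mul (by positivity)]
        congr 1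
        simp only [nestedDensity, weight, qSq, kSq, kqSq]
        rw [show (b.1 - a.1) ^ 2 + a.2 ^ 2 + (b.2.1 ^ 2 + b.2.2 ^ 2) - 2 * (a.2 * b.2.1) =
          (b.1 - a.1) ^ 2 + (b.2.1 - a.2) ^ 2 + b.2.2 ^ 2 by ring, add_assoc, add_assoc, add_assoc,
          mul_assoc]
    _ = ∫⁻ a in oneLoopRegion, ENNReal.ofReal (a.2 ^ (D - 2) *
        (((a.1 - c) ^ 2 + a.2 ^ 2) ^ (-α) * ((a.1 - e) ^ 2 + a.2 ^ 2) ^ (-β))) *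
        ∫⁻ b in halfSpace, ENNReal.ofReal (b.2.2 ^ (D - 3) *
          (((b.1 - (e, (0 : ℝ)).1) ^ 2 + (b.2.1 - (e, (0 : ℝ)).2) ^ 2 + b.2.2 ^ 2) ^ (-1 : ℝ) *
            ((b.1 - a.1) ^ 2 + (b.2.1 - a.2) ^ 2 + b.2.2 ^ 2) ^ (-1 : ℝ))) := by
        -- The coordinates resolve two components of `k` relative to `q`. To integrate over `q`
        -- first the roles are exchanged, which requires `(k - q)²` in terms of the invariants. From
        -- here on `a` stands for `k` and `b` for `q`.
        refine (lintegral_twoLoop_swap D (H := fun y : ℝ × ℝ × ℝ × ℝ × ℝ => ENNReal.ofReal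
            (((y.1 - e) ^ 2 + y.2.2.1 ^ 2) ^ (-1 : ℝ) *
            ((y.2.1 - y.1) ^ 2 + y.2.2.1 ^ 2 + y.2.2.2.1 ^ 2 - 2 * y.2.2.2.2) ^ (-1 : ℝ) *
            (((y.2.1 - c) ^ 2 + y.2.2.2.1 ^ 2) ^ (-α) * ((y.2.1 - e) ^ 2 + y.2.2.2.1 ^ 2) ^ (-β))))
          (by fun_prop)).trans ?_
        refine setLIntegral_congr_fun measurableSet_oneLoopRegion fun a ha => ?_
        have ha : 0 < a.2 := ha
        simp only
        rw [← lintegral_const_mul' _ _ ENNReal.ofReal_ne_top]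
        refine setLIntegral_congr_fun measurableSet_halfSpace fun b hb => ?_
        have hb : 0 < b.2.2 := hb
        rw [Real.sq_sqrt (by positivity), ← ENNReal.ofReal_mul (by positivity),
          ← ENNReal.ofReal_mul (by positivity)]
        congr 1
        rw [show (a.1 - b.1) ^ 2 + (b.2.1 ^ 2 + b.2.2 ^ 2) + a.2 ^ 2 - 2 * (a.2 * b.2.1) =
          (b.1 - a.1) ^ 2 + (b.2.1 - a.2) ^ 2 + b.2.2 ^ 2 by ring, sub_zero]
        ring_nf
    _ = ∫⁻ a in oneLoopRegion, ENNReal.ofReal (spaceConst D * realOneLoopG D 1 1) *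
        ENNReal.ofReal (a.2 ^ (D - 2) * (((a.1 - c) ^ 2 + a.2 ^ 2) ^ (-α) *
          ((a.1 - e) ^ 2 + a.2 ^ 2) ^ (-(2 + β - D / 2)))) := by
        have hG : 0 < spaceConst D * realOneLoopG D 1 1 := mul_pos (spaceConst_pos hD2)
          (realOneLoopG_pos (by linarith) (by linarith) (by linarith))
        refine setLIntegral_congr_fun measurableSet_oneLoopRegion fun a ha => ?_
        have ha : 0 < a.2 := ha
        simp only
        have hpos : 0 < (a.1 - e) ^ 2 + a.2 ^ 2 := by positivity
        have e1 : (e - a.1) ^ 2 + (0 - a.2) ^ 2 = (a.1 - e) ^ 2 + a.2 ^ 2 := by ring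
        rw [lintegral_space_rpow hD2 (by linarith) (by linarith) (by linarith)
          (a := (e, 0)) (b := a) (by rw [e1]; exact hpos), ← ENNReal.ofReal_mul (by positivity),
          ← ENNReal.ofReal_mul hG.le]
        congr 1
        simp only [e1]
        rw [show -(2 + β - D / 2) = -β + (D / 2 - 1 - 1) by ring, Real.rpow_add hpos]
        ring
    _ = _ := by
        rw [lintegral_const_mul' _ _ ENNReal.ofReal_ne_top,
          lintegral_plane_rpow (by linarith) hα (by linarith) (by linarith) hce,
          ← ENNReal.ofReal_mul (mul_nonneg (spaceConst_pos hD2).le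
            (realOneLoopG_pos (by linarith) (by linarith) (by linarith)).le)]
        congr 1
        rw [show D / 2 - α - (2 + β - D / 2) = D - α - β - 2 by ring]
        ring

/-! ### Integration by parts -/

section Euler

variable {X : Type*} [MeasurableSpace X] {m : Measure X} {S : ℝ → X → X} {d : ℝ}

theorem integral_comp_scaling (hS : ∀ t, Measurable (S t))
    (hmap : ∀ t, 0 < t → m.map (S t) = ENNReal.ofReal (t ^ (-d)) • m) {g : X → ℝ}
    (hg : Measurable g) {t : ℝ} (ht : 0 < t) :
    ∫ x, g (S t x) ∂m = t ^ (-d) * ∫ x, g x ∂m := by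
  rw [← integral_map (hS t).aemeasurable hg.aestronglyMeasurable, hmap t ht, integral_smul_measure,
    ENNReal.toReal_ofReal (by positivity), smul_eq_mul]

theorem integrable_comp_scaling (hS : ∀ t, Measurable (S t))
    (hmap : ∀ t, 0 < t → m.map (S t) = ENNReal.ofReal (t ^ (-d)) • m) {g : X → ℝ}
    (hgi : Integrable g m) {t : ℝ} (ht : 0 < t) :
    Integrable (fun x => g (S t x)) m := by
  have : Integrable g (m.map (S t)) := by
    rw [hmap t ht]
    exact hgi.smul_measure ENNReal.ofReal_ne_top
  exact this.comp_measurable (hS t)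

/-- The integral of the derivative of a function along the orbits of a group of dilations. -/
theorem integral_euler [SFinite m] (hd : 0 < d) (hS : Measurable (Function.uncurry S))
    (hmap : ∀ t, 0 < t → m.map (S t) = ENNReal.ofReal (t ^ (-d)) • m)
    (hS1 : ∀ᵐ x ∂m, S 1 x = x) {Φ E : X → ℝ} (hE : Measurable E)
    (hΦi : Integrable Φ m) (hEi : Integrable E m)
    (hderiv : ∀ᵐ x ∂m, ∀ t : ℝ, 0 < t →
      HasDerivAt (fun t => Φ (S t x)) (t⁻¹ * E (S t x)) t) :
    ∫ x, E x ∂m = -d * ∫ x, Φ x ∂m := by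
  have hSt : ∀ t, Measurable (S t) := fun t => hS.comp measurable_prodMk_left
  have hpos : ∀ t ∈ Set.Ioc (1 : ℝ) 2, 0 < t := fun t ht => one_pos.trans ht.1
  have hrpow : ∀ t : ℝ, 0 < t → t⁻¹ * t ^ (-d) = t ^ (-d - 1) := fun t ht => by
    rw [Real.rpow_sub ht, Real.rpow_one]; ring
  have h0 : (0 : ℝ) ∉ Set.uIcc (1 : ℝ) 2 := by
    rw [Set.uIcc_of_le (by norm_num)]; exact fun h => by linarith [h.1]
  have hF : Integrable (fun y : ℝ × X => y.1⁻¹ * E (S y.1 y.2))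
      ((volume.restrict (Set.Ioc (1 : ℝ) 2)).prod m) := by
    have hm : Measurable (fun y : ℝ × X => y.1⁻¹ * E (S y.1 y.2)) :=
      measurable_fst.inv.mul (hE.comp hS)
    rw [integrable_prod_iff hm.aestronglyMeasurable]
    constructor
    · filter_upwards [self_mem_ae_restrict measurableSet_Ioc] with t ht
      exact (integrable_comp_scaling hSt hmap hEi (hpos t ht)).const_mul _
    · have : IntegrableOn (fun t : ℝ => t ^ (-d - 1) * ∫ x, ‖E x‖ ∂m) (Set.Ioc 1 2) :=
        ((intervalIntegrable_iff_integrableOn_Ioc_of_le (by norm_num)).1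
          (intervalIntegral.intervalIntegrable_rpow (Or.inr h0))).mul_const _
      refine this.congr_fun (fun t ht => ?_) measurableSet_Ioc
      have ht := hpos t ht
      simp only [norm_mul, norm_inv, Real.norm_eq_abs, abs_of_pos ht]
      rw [integral_const_mul, integral_comp_scaling (g := fun x => |E x|) hSt hmap (by fun_prop) ht,
        ← mul_assoc, hrpow t ht]
  -- Fundamental theorem of calculus along the orbit from `t = 1` to `t = 2`.
  have hftc : ∀ᵐ x ∂m, Φ (S 2 x) - Φ x = ∫ t in Set.Ioc (1 : ℝ) 2, t⁻¹ * E (S t x) := by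
    filter_upwards [hderiv, hS1, hF.prod_left_ae] with x hx h1 hxi
    have hI : IntervalIntegrable (fun t => t⁻¹ * E (S t x)) volume 1 2 :=
      (intervalIntegrable_iff_integrableOn_Ioc_of_le one_le_two).2 hxi
    have h := intervalIntegral.integral_eq_sub_of_hasDerivAt (f := fun t => Φ (S t x))
      (fun t ht => hx t (by
        rw [Set.uIcc_of_le one_le_two] at ht
        exact one_pos.trans_le ht.1)) hI
    rw [← intervalIntegral.integral_of_le one_le_two, h, h1]
  -- The integral of `Φ ∘ S 2 - Φ` is computed by scaling of the measure and, by Fubini, from the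
  -- derivative. The common factor `2 ^ (-d) - 1` is nonzero since `d > 0`. No boundary term ever
  -- arises.
  have key : (2 ^ (-d) - 1) * ∫ x, Φ x ∂m = (2 ^ (-d) - 1) / (-d) * ∫ x, E x ∂m := by
    calc _ = ∫ x, (Φ (S 2 x) - Φ x) ∂m := by
          rw [integral_sub (integrable_comp_scaling hSt hmap hΦi two_pos) hΦi]
          have : ∫ x, Φ (S 2 x) ∂m = 2 ^ (-d) * ∫ x, Φ x ∂m := by
            have h : AEStronglyMeasurable Φ (m.map (S 2)) := by
              rw [hmap 2 two_pos]
              exact hΦi.1.smul_measure _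
            rw [← integral_map (hSt 2).aemeasurable h, hmap 2 two_pos, integral_smul_measure,
              ENNReal.toReal_ofReal (by positivity), smul_eq_mul]
          rw [this]
          ring
      _ = ∫ x, (∫ t in Set.Ioc (1 : ℝ) 2, t⁻¹ * E (S t x)) ∂m := integral_congr_ae hftc
      _ = ∫ t in Set.Ioc (1 : ℝ) 2, ∫ x, t⁻¹ * E (S t x) ∂m :=
          integral_integral_swap (f := fun x t => t⁻¹ * E (S t x)) hF.swap
      _ = ∫ t in Set.Ioc (1 : ℝ) 2, t ^ (-d - 1) * ∫ x, E x ∂m := by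
          refine setIntegral_congr_fun measurableSet_Ioc fun t ht => ?_
          have ht := hpos t ht
          rw [integral_const_mul, integral_comp_scaling hSt hmap hE ht, ← mul_assoc, hrpow t ht]
      _ = _ := by
          rw [integral_mul_const, ← intervalIntegral.integral_of_le (by norm_num),
            integral_rpow (Or.inr ⟨by linarith, h0⟩), sub_add_cancel, Real.one_rpow]
  have h2 : (2 : ℝ) ^ (-d) - 1 ≠ 0 :=
    (sub_neg.2 (Real.rpow_lt_one_of_one_lt_of_neg one_lt_two (by linarith))).ne
  field_simp at key
  linarith

end Euler

/-! ### Dilations of `k` about `q` and the triangle relation -/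

/-- The dilation of the loop momentum `k` with centre `q`. -/
def dilation (t : ℝ) (x : ℝ × ℝ × ℝ × ℝ × ℝ) : ℝ × ℝ × ℝ × ℝ × ℝ :=
  (x.1, x.2.1, x.1 + t * (x.2.2.1 - x.1), x.2.1 + t * (x.2.2.2.1 - x.2.1), t * x.2.2.2.2)

/-- The exponent is 3, not `D`, because only Lebesgue measure on the three coordinates of `k` scales
here; the weight `r ^ (D - 3)` is kept in the integrand and supplies the other `D - 3`. -/
theorem lintegral_halfSpace_dilation {g : ℝ × ℝ × ℝ → ENNReal} {t : ℝ} (ht : 0 < t) (a : ℝ × ℝ) :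
    ∫⁻ b in halfSpace, g (a.1 + t * (b.1 - a.1), a.2 + t * (b.2.1 - a.2), t * b.2.2) =
      ENNReal.ofReal (t ^ (-3 : ℝ)) * ∫⁻ b in halfSpace, g b := by
  set c : ℝ × ℝ × ℝ := (a.1, a.2, 0)
  have hmem : ∀ b : ℝ × ℝ × ℝ, c + t • (b - c) ∈ halfSpace ↔ b ∈ halfSpace := fun b => by
    simp [halfSpace, c, ht]
  have : (volume : Measure (ℝ × ℝ)).IsAddHaarMeasure := by
    rw [Measure.volume_eq_prod]; infer_instance
  have : (volume : Measure (ℝ × ℝ × ℝ)).IsAddHaarMeasure := by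
    rw [Measure.volume_eq_prod]; infer_instance
  have hmap := Measure.map_addHaar_smul (volume : Measure (ℝ × ℝ × ℝ)) ht.ne'
  have hme : MeasurableEmbedding (fun b : ℝ × ℝ × ℝ => t • b) :=
    (Homeomorph.smulOfNeZero t ht.ne').measurableEmbedding
  rw [← lintegral_indicator measurableSet_halfSpace, ← lintegral_indicator measurableSet_halfSpace]
  calc _ = ∫⁻ b, halfSpace.indicator g (c + t • (b - c)) := by
        refine lintegral_congr fun b => ?_
        by_cases hb : b ∈ halfSpace
        · rw [Set.indicator_of_mem hb, Set.indicator_of_mem ((hmem b).2 hb)]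
          congr 1
          ext <;> simp [c]
        · rw [Set.indicator_of_notMem hb, Set.indicator_of_notMem (fun h => hb ((hmem b).1 h))]
    _ = ∫⁻ b, halfSpace.indicator g (c + t • b) :=
        lintegral_sub_right_eq_self (fun b => halfSpace.indicator g (c + t • b)) c
    _ = ∫⁻ b, halfSpace.indicator g (c + b) ∂((volume : Measure (ℝ × ℝ × ℝ)).map (t • ·)) :=
        (hme.lintegral_map fun b => halfSpace.indicator g (c + b)).symm
    _ = _ := by
        rw [hmap, lintegral_smul_measure, lintegral_add_left_eq_self, smul_eq_mul]
        congr 2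
        rw [abs_of_pos (by positivity), Real.rpow_neg ht.le]
        norm_num

theorem measurable_dilation : Measurable (Function.uncurry dilation) := by
  unfold dilation Function.uncurry
  fun_prop

theorem map_dilation {t : ℝ} (ht : 0 < t) : (volume.restrict twoLoopRegion).map (dilation t) =
    ENNReal.ofReal (t ^ (-3 : ℝ)) • volume.restrict twoLoopRegion := by
  have hm : Measurable (dilation t) := measurable_dilation.comp measurable_prodMk_left
  refine Measure.ext_of_lintegral _ fun f hf => ?_
  rw [lintegral_map hf hm, lintegral_smul_measure,
    lintegral_twoLoopRegion (f := fun x => f (dilation t x)) (hf.comp hm),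
    lintegral_twoLoopRegion hf, smul_eq_mul, ← lintegral_const_mul' _ _ ENNReal.ofReal_ne_top]
  exact lintegral_congr fun a =>
    lintegral_halfSpace_dilation (g := fun b => f (a.1, a.2, b)) ht a

/-- The density of the two-loop diagram with indices `(α₁, 1, 1, α₄, 1)`. -/
def triangleDensity (D p α₁ α₄ : ℝ) (x : ℝ × ℝ × ℝ × ℝ × ℝ) : ℝ :=
  weight D x * (kSq p x ^ (-α₁) * qSq p x ^ (-1 : ℝ) * qSq 0 x ^ (-1 : ℝ) * kSq 0 x ^ (-α₄) *
    kqSq x ^ (-1 : ℝ))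

/-- The derivative of `triangleDensity` along the dilations of `k` with centre `q`. -/
def triangleEuler (D p α₁ α₄ : ℝ) (x : ℝ × ℝ × ℝ × ℝ × ℝ) : ℝ :=
  (D - 5 - α₁ - α₄) * triangleDensity D p α₁ α₄ x
    - α₁ * (productDensity D p 0 (1 + α₁) α₄ x - nestedDensity D p 0 (1 + α₁) α₄ x)
    - α₄ * (productDensity D p 0 α₁ (1 + α₄) x - nestedDensity D 0 p (1 + α₄) α₁ x)

/-- The bracket is the logarithmic derivative: `D - 3` from the weight, `-2` from the line `k - q`,
and the `k`-lines through `2 (k - q)·(k - c) = (k - q)² + (k - c)² - (q - c)²`. The summand `(k -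
c)²` cancels its own line and lowers the coefficient to `D - 5 - α₁ - α₄`. -/
theorem triangleEuler_eq (D p α₁ α₄ : ℝ) {x : ℝ × ℝ × ℝ × ℝ × ℝ} (hx : x ∈ twoLoopRegion) :
    triangleEuler D p α₁ α₄ x = triangleDensity D p α₁ α₄ x *
      ((D - 3) - α₁ * ((kqSq x + kSq p x - qSq p x) / kSq p x)
        - α₄ * ((kqSq x + kSq 0 x - qSq 0 x) / kSq 0 x) - 2) := by
  have h1 := kSq_pos p hx
  have h2 := qSq_pos p hx
  have h3 := qSq_pos 0 hx
  have h4 := kSq_pos 0 hx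
  have h5 := kqSq_pos hx
  simp only [triangleEuler, triangleDensity, productDensity, nestedDensity]
  rw [show -(1 + α₁) = -α₁ - 1 by ring, show -(1 + α₄) = -α₄ - 1 by ring, Real.rpow_sub h1,
    Real.rpow_sub h4, Real.rpow_neg_one, Real.rpow_neg_one, Real.rpow_neg_one, Real.rpow_one,
    Real.rpow_one]
  field_simp
  ring

theorem dilation_mem {t : ℝ} (ht : 0 < t) {x : ℝ × ℝ × ℝ × ℝ × ℝ} (hx : x ∈ twoLoopRegion) :
    dilation t x ∈ twoLoopRegion :=
  ⟨hx.1, mul_pos ht hx.2⟩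

theorem hasDerivAt_rpow_logDeriv {f : ℝ → ℝ} {f' e t : ℝ} (hf : HasDerivAt f f' t)
    (hpos : 0 < f t) : HasDerivAt (fun t => f t ^ e) (f t ^ e * (e * (f' / f t))) t := by
  convert hf.rpow_const (p := e) (Or.inl hpos.ne') using 1
  rw [Real.rpow_sub hpos, Real.rpow_one]
  ring

theorem hasDerivAt_triangleDensity (D p α₁ α₄ : ℝ) {x : ℝ × ℝ × ℝ × ℝ × ℝ}
    (hx : x ∈ twoLoopRegion) {t : ℝ} (ht : 0 < t) :
    HasDerivAt (fun t => triangleDensity D p α₁ α₄ (dilation t x))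
      (t⁻¹ * triangleEuler D p α₁ α₄ (dilation t x)) t := by
  have hm := dilation_mem ht hx
  have hk : ∀ c, HasDerivAt (fun t => kSq c (dilation t x))
      (t⁻¹ * (kqSq (dilation t x) + kSq c (dilation t x) - qSq c (dilation t x))) t := fun c => by
    have : HasDerivAt (fun t => (x.1 + t * (x.2.2.1 - x.1) - c) ^ 2 +
        (x.2.1 + t * (x.2.2.2.1 - x.2.1)) ^ 2 + (t * x.2.2.2.2) ^ 2) _ t :=
      (((((((hasDerivAt_id t).mul_const (x.2.2.1 - x.1)).const_add x.1).sub_const c).pow 2).add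
        ((((hasDerivAt_id t).mul_const (x.2.2.2.1 - x.2.1)).const_add x.2.1).pow 2)).add
        (((hasDerivAt_id t).mul_const x.2.2.2.2).pow 2))
    refine this.congr_deriv ?_
    simp only [kSq, kqSq, qSq, dilation, id, Nat.add_one_sub_one, pow_one, Nat.cast_ofNat, one_mul]
    field_simp
    ring
  have hkq : HasDerivAt (fun t => kqSq (dilation t x)) (t⁻¹ * (2 * kqSq (dilation t x))) t := by
    have : HasDerivAt (fun t => (x.1 + t * (x.2.2.1 - x.1) - x.1) ^ 2 +
        (x.2.1 + t * (x.2.2.2.1 - x.2.1) - x.2.1) ^ 2 + (t * x.2.2.2.2) ^ 2) _ t :=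
      (((((((hasDerivAt_id t).mul_const (x.2.2.1 - x.1)).const_add x.1).sub_const x.1).pow 2).add
        (((((hasDerivAt_id t).mul_const (x.2.2.2.1 - x.2.1)).const_add x.2.1).sub_const x.2.1).pow
          2)).add (((hasDerivAt_id t).mul_const x.2.2.2.2).pow 2))
    refine this.congr_deriv ?_
    simp only [kqSq, dilation, id, Nat.add_one_sub_one, pow_one, Nat.cast_ofNat, one_mul]
    field_simp
    ring
  have hw : HasDerivAt (fun t => weight D (dilation t x))
      (weight D (dilation t x) * ((D - 3) * t⁻¹)) t := by
    have : HasDerivAt (fun t => x.2.1 ^ (D - 2) * (t * x.2.2.2.2) ^ (D - 3)) _ t :=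
      (hasDerivAt_rpow_logDeriv ((hasDerivAt_id t).mul_const x.2.2.2.2) hm.2).const_mul _
    refine this.congr_deriv ?_
    have h2 : 0 < x.2.2.2.2 := hx.2
    simp only [weight, dilation, id, one_mul]
    field_simp
  have hall := hw.mul (((((hasDerivAt_rpow_logDeriv (e := -α₁) (hk p) (kSq_pos p hm)).mul_const
    (qSq p x ^ (-1 : ℝ))).mul_const (qSq 0 x ^ (-1 : ℝ))).mul
      (hasDerivAt_rpow_logDeriv (e := -α₄) (hk 0) (kSq_pos 0 hm))).mul
        (hasDerivAt_rpow_logDeriv (e := -1) hkq (kqSq_pos hm)))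
  refine hall.congr_deriv ?_
  have h1 := kSq_pos p hm
  have h4 := kSq_pos 0 hm
  have h5 := kqSq_pos hm
  rw [triangleEuler_eq D p α₁ α₄ hm]
  have e1 : qSq p (dilation t x) = qSq p x := rfl
  have e2 : qSq 0 (dilation t x) = qSq 0 x := rfl
  simp only [triangleDensity, e1, e2, Pi.mul_apply]
  field_simp
  ring

theorem measurable_productDensity (D c e α β : ℝ) : Measurable (productDensity D c e α β) := by
  unfold productDensity; fun_prop

theorem measurable_nestedDensity (D c e α β : ℝ) : Measurable (nestedDensity D c e α β) := by
  unfold nestedDensity; fun_prop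

theorem measurable_triangleDensity (D p α₁ α₄ : ℝ) : Measurable (triangleDensity D p α₁ α₄) := by
  unfold triangleDensity; fun_prop

theorem measurable_triangleEuler (D p α₁ α₄ : ℝ) : Measurable (triangleEuler D p α₁ α₄) := by
  have h1 := measurable_triangleDensity D p α₁ α₄
  have h2 := measurable_productDensity D p 0 (1 + α₁) α₄
  have h3 := measurable_nestedDensity D p 0 (1 + α₁) α₄
  have h4 := measurable_productDensity D p 0 α₁ (1 + α₄)
  have h5 := measurable_nestedDensity D 0 p (1 + α₄) α₁
  unfold triangleEuler
  fun_prop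

theorem integral_eq_of_lintegral_ofReal {X : Type*} [MeasurableSpace X] {m : Measure X}
    {f : X → ℝ} (hm : Measurable f) (hf : 0 ≤ᵐ[m] f) {v : ℝ} (hv : 0 ≤ v)
    (h : ∫⁻ x, ENNReal.ofReal (f x) ∂m = ENNReal.ofReal v) :
    Integrable f m ∧ ∫ x, f x ∂m = v := by
  refine ⟨⟨hm.aestronglyMeasurable, ?_⟩, ?_⟩
  · rw [hasFiniteIntegral_iff_ofReal hf, h]
    exact ENNReal.ofReal_lt_top
  · rw [integral_eq_lintegral_of_nonneg_ae hf hm.aestronglyMeasurable, h, ENNReal.toReal_ofReal hv]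

theorem integral_productDensity {D c e α β : ℝ} (hD2 : 2 < D) (hD4 : D < 4) (hα : α < D / 2)
    (hβ : β < D / 2) (hαβ : D / 2 < α + β) (hce : 0 < (c - e) ^ 2) :
    IntegrableOn (productDensity D c e α β) twoLoopRegion ∧
    ∫ x in twoLoopRegion, productDensity D c e α β x =
      planeConst D * spaceConst D * ((c - e) ^ 2) ^ (D - α - β - 2) *
        (realOneLoopG D 1 1 * realOneLoopG D α β) := by
  refine integral_eq_of_lintegral_ofReal (measurable_productDensity D c e α β) ?_ ?_
    (lintegral_productDensity hD2 hD4 hα hβ hαβ hce)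
  · filter_upwards [self_mem_ae_restrict measurableSet_twoLoopRegion] with x hx
    have h0 := weight_pos D hx
    have h1 := kSq_pos c hx
    have h2 := qSq_pos c hx
    have h3 := qSq_pos e hx
    have h4 := kSq_pos e hx
    unfold productDensity
    show 0 ≤ _
    positivity
  · have h1 := planeConst_pos (D := D) (by linarith)
    have h2 := spaceConst_pos hD2
    have h3 := realOneLoopG_pos (D := D) (α := 1) (β := 1) (by linarith) (by linarith) (by linarith)
    have h4 := realOneLoopG_pos hα hβ hαβ
    positivity

theorem integral_nestedDensity {D c e α β : ℝ} (hD2 : 2 < D) (hD4 : D < 4) (hα : α < D / 2)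
    (hβ : β < D - 2) (hαβ : D - 2 < α + β) (hce : 0 < (c - e) ^ 2) :
    IntegrableOn (nestedDensity D c e α β) twoLoopRegion ∧
    ∫ x in twoLoopRegion, nestedDensity D c e α β x =
      planeConst D * spaceConst D * ((c - e) ^ 2) ^ (D - α - β - 2) *
        (realOneLoopG D 1 1 * realOneLoopG D α (2 + β - D / 2)) := by
  refine integral_eq_of_lintegral_ofReal (measurable_nestedDensity D c e α β) ?_ ?_
    (lintegral_nestedDensity hD2 hD4 hα hβ hαβ hce)
  · filter_upwards [self_mem_ae_restrict measurableSet_twoLoopRegion] with x hx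
    have h0 := weight_pos D hx
    have h1 := kSq_pos c hx
    have h2 := kqSq_pos hx
    have h3 := qSq_pos e hx
    have h4 := kSq_pos e hx
    unfold nestedDensity
    show 0 ≤ _
    positivity
  · have h1 := planeConst_pos (D := D) (by linarith)
    have h2 := spaceConst_pos hD2
    have h3 := realOneLoopG_pos (D := D) (α := 1) (β := 1) (by linarith) (by linarith) (by linarith)
    have h4 := realOneLoopG_pos (D := D) (α := α) (β := 2 + β - D / 2) hα (by linarith)
      (by linarith)
    positivity

theorem triangleDensity_nonneg (D p α₁ α₄ : ℝ) {x : ℝ × ℝ × ℝ × ℝ × ℝ} (hx : x ∈ twoLoopRegion) :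
    0 ≤ triangleDensity D p α₁ α₄ x := by
  have h0 := weight_pos D hx
  have h1 := kSq_pos p hx
  have h2 := qSq_pos p hx
  have h3 := qSq_pos 0 hx
  have h4 := kSq_pos 0 hx
  have h5 := kqSq_pos hx
  unfold triangleDensity
  positivity

/-- From `(k - p)² ≤ 2 ((k - q)² + (q - p)²)`. Convergence of the two-loop integral thus follows
from that of the explicitly computed ones. -/
theorem triangleDensity_le (D p α₁ α₄ : ℝ) {x : ℝ × ℝ × ℝ × ℝ × ℝ} (hx : x ∈ twoLoopRegion) :
    triangleDensity D p α₁ α₄ x ≤ 2 * (productDensity D p 0 (1 + α₁) α₄ x +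
      nestedDensity D p 0 (1 + α₁) α₄ x) := by
  have h1 := kSq_pos p hx
  have h2 := qSq_pos p hx
  have h3 := qSq_pos 0 hx
  have h4 := kSq_pos 0 hx
  have h5 := kqSq_pos hx
  have e : productDensity D p 0 (1 + α₁) α₄ x + nestedDensity D p 0 (1 + α₁) α₄ x =
      triangleDensity D p α₁ α₄ x * ((kqSq x + qSq p x) / kSq p x) := by
    simp only [triangleDensity, productDensity, nestedDensity]
    rw [show -(1 + α₁) = -α₁ - 1 by ring, Real.rpow_sub h1, Real.rpow_neg_one, Real.rpow_neg_one,
      Real.rpow_neg_one, Real.rpow_one]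
    field_simp
  have hle : 1 ≤ 2 * ((kqSq x + qSq p x) / kSq p x) := by
    rw [← mul_div_assoc, one_le_div h1]
    simp only [kSq, qSq, kqSq]
    nlinarith [sq_nonneg (x.2.2.1 - x.1 - (x.1 - p)), sq_nonneg (x.2.2.2.1 - x.2.1 - x.2.1),
      sq_nonneg x.2.2.2.2]
  rw [e]
  calc _ = triangleDensity D p α₁ α₄ x * 1 := (mul_one _).symm
    _ ≤ triangleDensity D p α₁ α₄ x * (2 * ((kqSq x + qSq p x) / kSq p x)) :=
        mul_le_mul_of_nonneg_left hle (triangleDensity_nonneg D p α₁ α₄ hx)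
    _ = _ := by ring

/-- The real parameters for which all integrals in the integration by parts converge. -/
def trianglePatch : Set (ℝ × ℝ × ℝ) :=
  {v | 2 < v.1 ∧ v.1 < 4 ∧ 1 + v.2.1 < v.1 / 2 ∧ 1 + v.2.2 < v.1 / 2 ∧
    v.2.1 < v.1 - 2 ∧ v.2.2 < v.1 - 2 ∧ v.1 / 2 < 1 + v.2.1 + v.2.2 ∧ v.1 - 2 < 1 + v.2.1 + v.2.2}

/-- The dilation identity gives `-3` times the integral on one side and `D - 5 - α₁ - α₄` times it
on the other, which combine to `D - α₁ - α₄ - 2`. In the second nested term `0` and `p` are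
interchanged, so `realOneLoopG_comm` restores the order of indices. -/
theorem integral_triangleDensity {D p α₁ α₄ : ℝ} (hp : 0 < p) (h : (D, α₁, α₄) ∈ trianglePatch) :
    IntegrableOn (triangleDensity D p α₁ α₄) twoLoopRegion ∧
    (D - α₁ - α₄ - 2) * ∫ x in twoLoopRegion, triangleDensity D p α₁ α₄ x =
      planeConst D * spaceConst D * (p ^ 2) ^ (D - α₁ - α₄ - 3) * (realOneLoopG D 1 1 *
        (α₁ * realOneLoopG D (1 + α₁) α₄ - α₁ * realOneLoopG D (1 + α₁) (2 + α₄ - D / 2)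
          + α₄ * realOneLoopG D α₁ (1 + α₄)
          - α₄ * realOneLoopG D (2 + α₁ - D / 2) (1 + α₄))) := by
  obtain ⟨h1, h2, h3, h4, h5, h6, h7, h8⟩ := h
  simp only at h1 h2 h3 h4 h5 h6 h7 h8
  have hpe : 0 < (p - 0) ^ 2 := by rw [sub_zero]; positivity
  have hpe' : 0 < (0 - p) ^ 2 := by rw [zero_sub, neg_sq]; positivity
  obtain ⟨i1, e1⟩ := integral_productDensity (α := 1 + α₁) (β := α₄) h1 h2 h3 (by linarith)
    (by linarith) hpe
  obtain ⟨i2, e2⟩ := integral_nestedDensity (α := 1 + α₁) (β := α₄) h1 h2 h3 h6 (by linarith) hpe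
  obtain ⟨i3, e3⟩ := integral_productDensity (α := α₁) (β := 1 + α₄) h1 h2 (by linarith) h4
    (by linarith) hpe
  obtain ⟨i4, e4⟩ := integral_nestedDensity (α := 1 + α₄) (β := α₁) h1 h2 h4 h5 (by linarith) hpe'
  have i0 : IntegrableOn (triangleDensity D p α₁ α₄) twoLoopRegion := by
    refine Integrable.mono' ((i1.add i2).const_mul 2)
      (measurable_triangleDensity D p α₁ α₄).aestronglyMeasurable ?_
    filter_upwards [self_mem_ae_restrict measurableSet_twoLoopRegion] with x hx
    rw [Real.norm_eq_abs, abs_of_nonneg (triangleDensity_nonneg D p α₁ α₄ hx)]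
    exact triangleDensity_le D p α₁ α₄ hx
  refine ⟨i0, ?_⟩
  have iA : Integrable (fun x => (D - 5 - α₁ - α₄) * triangleDensity D p α₁ α₄ x)
    (volume.restrict twoLoopRegion) := i0.const_mul _
  have iB : Integrable (fun x => α₁ * (productDensity D p 0 (1 + α₁) α₄ x -
    nestedDensity D p 0 (1 + α₁) α₄ x)) (volume.restrict twoLoopRegion) := (i1.sub i2).const_mul _
  have iC : Integrable (fun x => α₄ * (productDensity D p 0 α₁ (1 + α₄) x -
    nestedDensity D 0 p (1 + α₄) α₁ x)) (volume.restrict twoLoopRegion) := (i3.sub i4).const_mul _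
  have hsum : ∫ x in twoLoopRegion, triangleEuler D p α₁ α₄ x =
      (D - 5 - α₁ - α₄) * (∫ x in twoLoopRegion, triangleDensity D p α₁ α₄ x)
      - α₁ * ((∫ x in twoLoopRegion, productDensity D p 0 (1 + α₁) α₄ x) -
        ∫ x in twoLoopRegion, nestedDensity D p 0 (1 + α₁) α₄ x)
      - α₄ * ((∫ x in twoLoopRegion, productDensity D p 0 α₁ (1 + α₄) x) -
        ∫ x in twoLoopRegion, nestedDensity D 0 p (1 + α₄) α₁ x) := by
    unfold triangleEuler
    rw [integral_sub (f := fun x => _ - _) (iA.sub iB) iC, integral_sub iA iB,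
      integral_const_mul, integral_const_mul, integral_const_mul, integral_sub i1 i2, integral_sub i3 i4]
  have heul := integral_euler (m := volume.restrict twoLoopRegion) (S := dilation) (d := 3)
    (by norm_num) measurable_dilation (fun t ht => map_dilation ht)
    (Eventually.of_forall fun x => by simp [dilation])
    (measurable_triangleEuler D p α₁ α₄) i0 ((iA.sub iB).sub iC) (by
      filter_upwards [self_mem_ae_restrict measurableSet_twoLoopRegion] with x hx t ht
      exact hasDerivAt_triangleDensity D p α₁ α₄ hx ht)
  rw [hsum, e1, e2, e3, e4, sub_zero, zero_sub, neg_sq,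
    show D - (1 + α₁) - α₄ - 2 = D - α₁ - α₄ - 3 by ring,
    show D - α₁ - (1 + α₄) - 2 = D - α₁ - α₄ - 3 by ring,
    show D - (1 + α₄) - α₁ - 2 = D - α₁ - α₄ - 3 by ring,
    realOneLoopG_comm D (1 + α₄)] at heul
  linear_combination heul

/-! ### The integrands as exponential families -/

theorem cpow_eq_exp {r : ℝ} (hr : 0 < r) (z : ℂ) : (r : ℂ) ^ z = Complex.exp (Real.log r * z) := by
  rw [Complex.cpow_def_of_ne_zero (by exact_mod_cast hr.ne'), Complex.ofReal_log hr.le]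

theorem line_eq_exp {n : ℕ} (α : ℂ) {k : EuclideanSpace ℝ (Fin n)} {r : ℝ} (hr : 0 < r)
    (h : ‖k‖ ^ 2 = r) : line α k = Complex.exp (-(Real.log r * α)) := by
  rw [line, h, cpow_eq_exp hr, one_div, Complex.exp_neg]

/-- The part of the exponent of the one-loop integrand which does not depend on the parameters. -/
def oneLoopOffset (x : ℝ × ℝ) : ℝ := -2 * Real.log x.2

/-- The coefficients of the parameters `(D, α, β)` in the exponent of the one-loop integrand. -/
def oneLoopExponents (p : ℝ) (x : ℝ × ℝ) : ℝ × ℝ × ℝ :=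
  (Real.log x.2, -Real.log ((x.1 - 0) ^ 2 + x.2 ^ 2), -Real.log ((x.1 - p) ^ 2 + x.2 ^ 2))

theorem measurable_oneLoopOffset : Measurable oneLoopOffset := by
  unfold oneLoopOffset; fun_prop

theorem measurable_oneLoopExponents (p : ℝ) : Measurable (oneLoopExponents p) := by
  unfold oneLoopExponents; fun_prop

/-- On the region all bases are positive reals, so the complex powers merge into one exponential,
affine in the parameters. -/
theorem oneLoopDensity_eq (p : ℝ) (z : ℂ × ℂ × ℂ) {x : ℝ × ℝ} (hx : x ∈ oneLoopRegion) :
    oneLoopDensity z.1 (oneLoopIntegrand p z.2.1 z.2.2) x =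
      expFamily oneLoopOffset (oneLoopExponents p) z x := by
  have hx : 0 < x.2 := hx
  rw [oneLoopDensity, oneLoopIntegrand, cpow_eq_exp hx,
    line_eq_exp (r := (x.1 - 0) ^ 2 + x.2 ^ 2) _ (by positivity)
      (by simp [EuclideanSpace.norm_sq_eq, Fin.sum_univ_two]),
    line_eq_exp (r := (x.1 - p) ^ 2 + x.2 ^ 2) _ (by positivity)
      (by simp [EuclideanSpace.norm_sq_eq, Fin.sum_univ_two]; ring),
    ← Complex.exp_add, ← Complex.exp_add, expFamily, pairing, oneLoopOffset, oneLoopExponents]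
  congr 1
  push_cast
  ring

theorem oneLoopFamily_ofReals (p : ℝ) (v : ℝ × ℝ × ℝ) {x : ℝ × ℝ} (hx : x ∈ oneLoopRegion) :
    expFamily oneLoopOffset (oneLoopExponents p) (ofReals v) x =
      ((x.2 ^ (v.1 - 2) * (((x.1 - 0) ^ 2 + x.2 ^ 2) ^ (-v.2.1) *
        ((x.1 - p) ^ 2 + x.2 ^ 2) ^ (-v.2.2)) : ℝ) : ℂ) := by
  have hx : 0 < x.2 := hx
  rw [expFamily, pairing_ofReals, ← Complex.ofReal_add, ← Complex.ofReal_exp,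
    Real.rpow_def_of_pos hx, Real.rpow_def_of_pos (by positivity),
    Real.rpow_def_of_pos (by positivity), ← Real.exp_add, ← Real.exp_add, oneLoopOffset,
    oneLoopExponents]
  congr 2
  ring

theorem oneLoopDomain_eq (p : ℝ) : oneLoopDomain p =
    {z | Integrable (expFamily oneLoopOffset (oneLoopExponents p) z)
      (volume.restrict oneLoopRegion)} := by
  ext z
  exact integrableOn_congr_fun (fun x hx => oneLoopDensity_eq p z hx) measurableSet_oneLoopRegion

theorem convOneLoopJ_eq (p : ℝ) (z : ℂ × ℂ × ℂ) : convOneLoopJ p z =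
    sphereArea (z.1 - 1) / ((2 * Real.pi : ℝ) : ℂ) ^ z.1 *
      ∫ x in oneLoopRegion, expFamily oneLoopOffset (oneLoopExponents p) z x := by
  rw [convOneLoopJ, oneLoopInt, setIntegral_congr_fun measurableSet_oneLoopRegion
    fun x hx => oneLoopDensity_eq p z hx]

/-- The part of the exponent of the two-loop integrand which does not depend on the parameters. -/
def triangleOffset (p : ℝ) (x : ℝ × ℝ × ℝ × ℝ × ℝ) : ℝ :=
  -2 * Real.log x.2.1 - 3 * Real.log x.2.2.2.2 - Real.log (qSq p x) - Real.log (qSq 0 x)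
    - Real.log (kqSq x)

/-- The coefficients of the parameters `(D, α₁, α₄)` in the exponent of the two-loop integrand. -/
def triangleExponents (p : ℝ) (x : ℝ × ℝ × ℝ × ℝ × ℝ) : ℝ × ℝ × ℝ :=
  (Real.log x.2.1 + Real.log x.2.2.2.2, -Real.log (kSq p x), -Real.log (kSq 0 x))

theorem measurable_triangleOffset (p : ℝ) : Measurable (triangleOffset p) := by
  unfold triangleOffset; fun_prop

theorem measurable_triangleExponents (p : ℝ) : Measurable (triangleExponents p) := by
  unfold triangleExponents; fun_prop

theorem twoLoopDensity_eq (p : ℝ) (z : ℂ × ℂ × ℂ) {x : ℝ × ℝ × ℝ × ℝ × ℝ}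
    (hx : x ∈ twoLoopRegion) :
    twoLoopDensity z.1 (twoLoopIntegrand p z.2.1 1 1 z.2.2 1) x =
      expFamily (triangleOffset p) (triangleExponents p) z x := by
  rw [twoLoopDensity, twoLoopIntegrand, cpow_eq_exp hx.1, cpow_eq_exp hx.2,
    line_eq_exp _ (kSq_pos p hx) (by simp [EuclideanSpace.norm_sq_eq, Fin.sum_univ_three, kSq]),
    line_eq_exp _ (qSq_pos p hx) (by simp [EuclideanSpace.norm_sq_eq, Fin.sum_univ_three, qSq]),
    line_eq_exp _ (qSq_pos 0 hx) (by simp [EuclideanSpace.norm_sq_eq, Fin.sum_univ_three, qSq]),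
    line_eq_exp _ (kSq_pos 0 hx) (by simp [EuclideanSpace.norm_sq_eq, Fin.sum_univ_three, kSq]),
    line_eq_exp _ (kqSq_pos hx) (by simp [EuclideanSpace.norm_sq_eq, Fin.sum_univ_three, kqSq]),
    ← Complex.exp_add, ← Complex.exp_add, ← Complex.exp_add, ← Complex.exp_add, ← Complex.exp_add,
    ← Complex.exp_add, expFamily, pairing, triangleOffset, triangleExponents]
  congr 1
  push_cast
  ring

theorem triangleFamily_ofReals (p : ℝ) (v : ℝ × ℝ × ℝ) {x : ℝ × ℝ × ℝ × ℝ × ℝ}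
    (hx : x ∈ twoLoopRegion) :
    expFamily (triangleOffset p) (triangleExponents p) (ofReals v) x =
      ((triangleDensity v.1 p v.2.1 v.2.2 x : ℝ) : ℂ) := by
  rw [expFamily, pairing_ofReals, ← Complex.ofReal_add, ← Complex.ofReal_exp, triangleDensity,
    weight, Real.rpow_def_of_pos hx.1, Real.rpow_def_of_pos hx.2,
    Real.rpow_def_of_pos (kSq_pos p hx), Real.rpow_def_of_pos (qSq_pos p hx),
    Real.rpow_def_of_pos (qSq_pos 0 hx), Real.rpow_def_of_pos (kSq_pos 0 hx),
    Real.rpow_def_of_pos (kqSq_pos hx), ← Real.exp_add, ← Real.exp_add, ← Real.exp_add,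
    ← Real.exp_add, ← Real.exp_add, ← Real.exp_add, triangleOffset, triangleExponents]
  congr 2
  ring

theorem triangleDomain_eq (p : ℝ) : triangleDomain p =
    {z | Integrable (expFamily (triangleOffset p) (triangleExponents p) z)
      (volume.restrict twoLoopRegion)} := by
  ext z
  exact integrableOn_congr_fun (fun x hx => twoLoopDensity_eq p z hx) measurableSet_twoLoopRegion

theorem convTriangleJ_eq (p : ℝ) (z : ℂ × ℂ × ℂ) : convTriangleJ p z =
    sphereArea (z.1 - 1) * sphereArea (z.1 - 2) / (((2 * Real.pi : ℝ) : ℂ) ^ z.1) ^ 2 *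
      ∫ x in twoLoopRegion, expFamily (triangleOffset p) (triangleExponents p) z x := by
  rw [convTriangleJ, twoLoopInt, setIntegral_congr_fun measurableSet_twoLoopRegion
    fun x hx => twoLoopDensity_eq p z hx]

/-! ### The meromorphic continuations -/

/-- The numerator of the coefficient function of the one-loop diagram. -/
def oneLoopNum (D α β : ℂ) : ℂ :=
  (Complex.Gamma α)⁻¹ * (Complex.Gamma β)⁻¹ * (Complex.Gamma (D - α - β))⁻¹

/-- The denominator of the coefficient function of the one-loop diagram. -/
def oneLoopDen (D α β : ℂ) : ℂ :=
  (Complex.Gamma (D / 2 - α))⁻¹ * (Complex.Gamma (D / 2 - β))⁻¹ *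
    (Complex.Gamma (α + β - D / 2))⁻¹

section Differentiability

variable {E : Type*} [NormedAddCommGroup E] [NormedSpace ℂ E] {f g h : E → ℂ}

/-- At its poles `Complex.Gamma` takes the value 0, so the inverse is also 0 there, which is the
true value of the entire function `1/Γ`. -/
theorem differentiable_inv_Gamma (hf : Differentiable ℂ f) :
    Differentiable ℂ fun z => (Complex.Gamma (f z))⁻¹ :=
  Complex.differentiable_one_div_Gamma.comp hf

theorem differentiable_ofReal_cpow {r : ℝ} (hr : 0 < r) (hf : Differentiable ℂ f) :
    Differentiable ℂ fun z => (r : ℂ) ^ f z := by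
  simp only [cpow_eq_exp hr]
  fun_prop

theorem differentiable_div_ofReal_cpow {r : ℝ} (hr : 0 < r) (hg : Differentiable ℂ g)
    (hf : Differentiable ℂ f) : Differentiable ℂ fun z => g z / (r : ℂ) ^ f z := by
  simp only [div_eq_mul_inv, ← Complex.cpow_neg]
  exact hg.mul (differentiable_ofReal_cpow hr hf.neg)

theorem differentiable_oneLoopNum (hf : Differentiable ℂ f) (hg : Differentiable ℂ g)
    (hh : Differentiable ℂ h) : Differentiable ℂ fun z => oneLoopNum (f z) (g z) (h z) :=
  ((differentiable_inv_Gamma hg).mul (differentiable_inv_Gamma hh)).mul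
    (differentiable_inv_Gamma (by fun_prop))

theorem differentiable_oneLoopDen (hf : Differentiable ℂ f) (hg : Differentiable ℂ g)
    (hh : Differentiable ℂ h) : Differentiable ℂ fun z => oneLoopDen (f z) (g z) (h z) :=
  ((differentiable_inv_Gamma (by fun_prop)).mul (differentiable_inv_Gamma (by fun_prop))).mul
    (differentiable_inv_Gamma (by fun_prop))

theorem differentiable_sphereArea (hf : Differentiable ℂ f) :
    Differentiable ℂ fun z => sphereArea (f z) := by
  unfold sphereArea
  simp only [div_eq_mul_inv _ (Complex.Gamma _)]
  exact ((differentiable_ofReal_cpow Real.pi_pos (by fun_prop)).const_mul 2).mul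
    (differentiable_inv_Gamma (by fun_prop))

end Differentiability

theorem ofReal_cpow_ne_zero {r : ℝ} (hr : 0 < r) (z : ℂ) : (r : ℂ) ^ z ≠ 0 := by
  rw [cpow_eq_exp hr]
  exact Complex.exp_ne_zero _

theorem inv_Gamma_ne_zero {s : ℂ} (h : ∀ n : ℕ, s ≠ -n) : (Complex.Gamma s)⁻¹ ≠ 0 :=
  inv_ne_zero (Complex.Gamma_ne_zero h)

theorem oneLoopDen_ne_zero {D α β : ℂ} (h1 : ∀ n : ℕ, D / 2 - α ≠ -n)
    (h2 : ∀ n : ℕ, D / 2 - β ≠ -n) (h3 : ∀ n : ℕ, α + β - D / 2 ≠ -n) : oneLoopDen D α β ≠ 0 :=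
  mul_ne_zero (mul_ne_zero (inv_Gamma_ne_zero h1) (inv_Gamma_ne_zero h2)) (inv_Gamma_ne_zero h3)

theorem oneLoopDen_mul_realOneLoopG {D α β : ℝ} (hα : α < D / 2) (hβ : β < D / 2)
    (hαβ : D / 2 < α + β) :
    oneLoopDen D α β * (realOneLoopG D α β : ℂ) = oneLoopNum D α β := by
  have h1 : Real.Gamma (D / 2 - α) ≠ 0 := (Real.Gamma_pos_of_pos (by linarith)).ne'
  have h2 : Real.Gamma (D / 2 - β) ≠ 0 := (Real.Gamma_pos_of_pos (by linarith)).ne'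
  have h3 : Real.Gamma (α + β - D / 2) ≠ 0 := (Real.Gamma_pos_of_pos (by linarith)).ne'
  have e : (Real.Gamma (D / 2 - α))⁻¹ * (Real.Gamma (D / 2 - β))⁻¹ *
      (Real.Gamma (α + β - D / 2))⁻¹ * realOneLoopG D α β =
      (Real.Gamma α)⁻¹ * (Real.Gamma β)⁻¹ * (Real.Gamma (D - α - β))⁻¹ := by
    unfold realOneLoopG
    generalize Real.Gamma (D / 2 - α) = a at *
    generalize Real.Gamma (D / 2 - β) = b at *
    generalize Real.Gamma (α + β - D / 2) = c at *
    field_simp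
  have := congrArg (fun r : ℝ => (r : ℂ)) e
  simp only [Complex.ofReal_mul, Complex.ofReal_inv, ← Complex.Gamma_ofReal] at this
  simpa [oneLoopDen, oneLoopNum] using this

/-! ### Normalization constants -/

theorem sphereArea_ofReal (d : ℝ) :
    sphereArea d = ((2 * Real.pi ^ (d / 2) / Real.Gamma (d / 2) : ℝ) : ℂ) := by
  rw [sphereArea]
  push_cast [Complex.ofReal_cpow Real.pi_pos.le, ← Complex.Gamma_ofReal]
  rfl

theorem four_pi_rpow (e : ℝ) :
    (4 * Real.pi) ^ (-e) = Real.pi ^ e / (2 * Real.pi) ^ (2 * e) := by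
  have hπ := Real.pi_pos
  rw [Real.rpow_mul (by positivity), Real.rpow_two, Real.rpow_neg (by positivity),
    eq_div_iff (by positivity), show (2 * Real.pi) ^ 2 = 4 * Real.pi * Real.pi by ring,
    Real.mul_rpow (x := 4 * Real.pi) (by positivity) hπ.le, inv_mul_cancel_left₀ (by positivity)]

theorem sphereArea_mul_planeConst {D : ℝ} (hD : 1 < D) :
    2 * Real.pi ^ ((D - 1) / 2) / Real.Gamma ((D - 1) / 2) * planeConst D = Real.pi ^ (D / 2) := by
  have : Real.Gamma ((D - 1) / 2) ≠ 0 := (Real.Gamma_pos_of_pos (by linarith)).ne'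
  rw [planeConst, show D / 2 = (D - 1) / 2 + 1 / 2 by ring, Real.rpow_add Real.pi_pos,
    Real.sqrt_eq_rpow]
  field_simp

theorem sphereArea_mul_spaceConst {D : ℝ} (hD : 2 < D) :
    2 * Real.pi ^ ((D - 2) / 2) / Real.Gamma ((D - 2) / 2) * spaceConst D = Real.pi ^ (D / 2) := by
  have : Real.Gamma ((D - 2) / 2) ≠ 0 := (Real.Gamma_pos_of_pos (by linarith)).ne'
  rw [spaceConst, show D / 2 = (D - 2) / 2 + 1 by ring, Real.rpow_add Real.pi_pos, Real.rpow_one]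
  field_simp

/-- The Gamma function in the sphere area cancels the one in the Gaussian weight, leaving `π ^ (D/2)
/ (2π) ^ D = (4π) ^ (-D/2)`. -/
theorem oneLoop_const {D : ℝ} (hD : 1 < D) :
    sphereArea (D - 1) / ((2 * Real.pi : ℝ) : ℂ) ^ (D : ℂ) * planeConst D =
      ((4 * Real.pi : ℝ) : ℂ) ^ (-(D / 2 : ℂ)) := by
  have h := four_pi_rpow (D / 2)
  rw [mul_div_cancel₀ D two_ne_zero, ← sphereArea_mul_planeConst hD] at h
  have := congrArg (fun r : ℝ => (r : ℂ)) h
  have e := sphereArea_ofReal (D - 1)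
  rw [Complex.ofReal_sub, Complex.ofReal_one] at e
  rw [e, ← Complex.ofReal_cpow (by positivity),
    show -(D / 2 : ℂ) = ((-(D / 2) : ℝ) : ℂ) by push_cast; rfl,
    ← Complex.ofReal_cpow (by positivity), this]
  push_cast
  ring

theorem twoLoop_const {D : ℝ} (hD : 2 < D) :
    sphereArea (D - 1) * sphereArea (D - 2) / (((2 * Real.pi : ℝ) : ℂ) ^ (D : ℂ)) ^ 2 *
      (planeConst D * spaceConst D) = ((4 * Real.pi : ℝ) : ℂ) ^ (-D : ℂ) := by
  have h := four_pi_rpow D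
  have hD2 : Real.pi ^ D = Real.pi ^ (D / 2) * Real.pi ^ (D / 2) := by
    rw [← Real.rpow_add Real.pi_pos, add_halves]
  have h2 : (2 * Real.pi) ^ (2 * D) = ((2 * Real.pi) ^ D) ^ 2 := by
    rw [mul_comm 2 D, Real.rpow_mul (by positivity), Real.rpow_two]
  rw [hD2, h2] at h
  nth_rewrite 1 [← sphereArea_mul_planeConst (show 1 < D by linarith)] at h
  rw [← sphereArea_mul_spaceConst hD] at h
  have := congrArg (fun r : ℝ => (r : ℂ)) h
  have e1 := sphereArea_ofReal (D - 1)
  have e2 := sphereArea_ofReal (D - 2)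
  rw [Complex.ofReal_sub, Complex.ofReal_one] at e1
  rw [Complex.ofReal_sub, Complex.ofReal_ofNat] at e2
  rw [e1, e2, ← Complex.ofReal_cpow (by positivity), ← Complex.ofReal_neg,
    ← Complex.ofReal_cpow (by positivity), this]
  push_cast
  ring

/-! ### Open sets of real parameters and the continuations from them -/

/-- The real parameters for which the one-loop integral converges. -/
def oneLoopPatch : Set (ℝ × ℝ × ℝ) :=
  {v | 1 < v.1 ∧ v.2.1 < v.1 / 2 ∧ v.2.2 < v.1 / 2 ∧ v.1 / 2 < v.2.1 + v.2.2}

theorem isOpen_oneLoopPatch : IsOpen oneLoopPatch := by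
  unfold oneLoopPatch
  repeat' apply IsOpen.and
  all_goals exact isOpen_lt (by fun_prop) (by fun_prop)

theorem oneLoopPatch_nonempty : oneLoopPatch.Nonempty :=
  ⟨(2, 3 / 4, 3 / 4), by norm_num [oneLoopPatch]⟩

theorem isOpen_trianglePatch : IsOpen trianglePatch := by
  unfold trianglePatch
  repeat' apply IsOpen.and
  all_goals exact isOpen_lt (by fun_prop) (by fun_prop)

theorem trianglePatch_nonempty : trianglePatch.Nonempty :=
  -- At `D = 3` with equal indices the conditions leave exactly the interval from `1/4` to `1/2`.
  ⟨(3, 2 / 5, 2 / 5), by norm_num [trianglePatch]⟩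

theorem integral_oneLoopFamily {p : ℝ} (hp : 0 < p) {v : ℝ × ℝ × ℝ} (hv : v ∈ oneLoopPatch) :
    Integrable (expFamily oneLoopOffset (oneLoopExponents p) (ofReals v))
      (volume.restrict oneLoopRegion) ∧
    ∫ x in oneLoopRegion, expFamily oneLoopOffset (oneLoopExponents p) (ofReals v) x =
      ((planeConst v.1 * realOneLoopG v.1 v.2.1 v.2.2 *
        (p ^ 2) ^ (v.1 / 2 - v.2.1 - v.2.2) : ℝ) : ℂ) := by
  obtain ⟨h1, h2, h3, h4⟩ := hv
  have hpe : (0 - p) ^ 2 = p ^ 2 := by ring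
  obtain ⟨hi, he⟩ := integral_eq_of_lintegral_ofReal (m := volume.restrict oneLoopRegion)
    (f := fun x : ℝ × ℝ => x.2 ^ (v.1 - 2) * (((x.1 - 0) ^ 2 + x.2 ^ 2) ^ (-v.2.1) *
      ((x.1 - p) ^ 2 + x.2 ^ 2) ^ (-v.2.2))) (by fun_prop) (by
        filter_upwards [self_mem_ae_restrict measurableSet_oneLoopRegion] with x hx
        have : 0 < x.2 := hx
        show 0 ≤ _
        positivity)
    (mul_nonneg (mul_nonneg (planeConst_pos h1).le (realOneLoopG_pos h2 h3 h4).le)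
      (by positivity)) (lintegral_plane_rpow h1 h2 h3 h4 (a := 0) (b := p) (by rw [hpe]; positivity))
  rw [hpe] at he
  refine ⟨(integrableOn_congr_fun (fun x hx => oneLoopFamily_ofReals p v hx)
    measurableSet_oneLoopRegion).2 hi.ofReal, ?_⟩
  rw [setIntegral_congr_fun measurableSet_oneLoopRegion fun x hx => oneLoopFamily_ofReals p v hx,
    integral_complex_ofReal, he]

theorem integral_triangleFamily {p : ℝ} (hp : 0 < p) {v : ℝ × ℝ × ℝ} (hv : v ∈ trianglePatch) :
    Integrable (expFamily (triangleOffset p) (triangleExponents p) (ofReals v))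
      (volume.restrict twoLoopRegion) ∧
    ∫ x in twoLoopRegion, expFamily (triangleOffset p) (triangleExponents p) (ofReals v) x =
      ((∫ x in twoLoopRegion, triangleDensity v.1 p v.2.1 v.2.2 x : ℝ) : ℂ) := by
  refine ⟨(integrableOn_congr_fun (fun x hx => triangleFamily_ofReals p v hx)
    measurableSet_twoLoopRegion).2 (integral_triangleDensity hp hv).1.ofReal, ?_⟩
  rw [setIntegral_congr_fun measurableSet_twoLoopRegion fun x hx => triangleFamily_ofReals p v hx,
    integral_complex_ofReal]

theorem oneLoopDomain_interior_nonempty {p : ℝ} (hp : 0 < p) :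
    (interior (oneLoopDomain p)).Nonempty := by
  rw [oneLoopDomain_eq]
  exact interior_integrable_expFamily_nonempty measurable_oneLoopOffset
    (measurable_oneLoopExponents p) isOpen_oneLoopPatch oneLoopPatch_nonempty
    fun v hv => (integral_oneLoopFamily hp hv).1

theorem triangleDomain_interior_nonempty {p : ℝ} (hp : 0 < p) :
    (interior (triangleDomain p)).Nonempty := by
  rw [triangleDomain_eq]
  exact interior_integrable_expFamily_nonempty (measurable_triangleOffset p)
    (measurable_triangleExponents p) isOpen_trianglePatch trianglePatch_nonempty
    fun v hv => (integral_triangleFamily hp hv).1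

/-- Numerator and denominator are products of reciprocal Gamma functions, up to exponential factors,
hence entire. The relation is checked on `oneLoopPatch` and transported to the whole convergence
domain. -/
theorem hasContinuation_oneLoop {p : ℝ} (hp : 0 < p) {D α β : ℂ} (hden : oneLoopDen D α β ≠ 0) :
    HasContinuation (oneLoopDomain p) (convOneLoopJ p) (D, α, β)
      (((p ^ 2 : ℝ) : ℂ) ^ (D / 2 - α - β) * ((4 * Real.pi : ℝ) : ℂ) ^ (-(D / 2)) *
        oneLoopNum D α β / oneLoopDen D α β) := by
  have hA : Differentiable ℂ fun z : ℂ × ℂ × ℂ => ((p ^ 2 : ℝ) : ℂ) ^ (z.1 / 2 - z.2.1 - z.2.2) *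
      ((4 * Real.pi : ℝ) : ℂ) ^ (-(z.1 / 2)) * oneLoopNum z.1 z.2.1 z.2.2 :=
    ((differentiable_ofReal_cpow (by positivity) (by fun_prop)).mul
      (differentiable_ofReal_cpow (by positivity) (by fun_prop))).mul
        (differentiable_oneLoopNum (by fun_prop) (by fun_prop) (by fun_prop))
  have hB : Differentiable ℂ fun z : ℂ × ℂ × ℂ => oneLoopDen z.1 z.2.1 z.2.2 :=
    differentiable_oneLoopDen (by fun_prop) (by fun_prop) (by fun_prop)
  have hc : Differentiable ℂ fun z : ℂ × ℂ × ℂ =>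
      sphereArea (z.1 - 1) / ((2 * Real.pi : ℝ) : ℂ) ^ z.1 :=
    differentiable_div_ofReal_cpow (by positivity) (differentiable_sphereArea (by fun_prop))
      (by fun_prop)
  refine ⟨_, _, hA, hB, fun z hz => ?_, hden, rfl⟩
  rw [oneLoopDomain_eq] at hz
  rw [convOneLoopJ_eq, ← mul_assoc]
  -- The entire prefactor of the integral is absorbed into the denominator function, so that the
  -- relation concerns the bare integral.
  refine mul_integral_expFamily_eq measurable_oneLoopOffset (measurable_oneLoopExponents p) hA
    (hB.mul hc) isOpen_oneLoopPatch oneLoopPatch_nonempty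
    (fun v hv => (integral_oneLoopFamily hp hv).1) (fun v hv => ?_) hz
  rw [(integral_oneLoopFamily hp hv).2]
  obtain ⟨h1, h2, h3, h4⟩ := hv
  simp only [Pi.mul_apply, ofReals]
  rw [← oneLoopDen_mul_realOneLoopG h2 h3 h4, ← oneLoop_const h1, Complex.ofReal_mul,
    Complex.ofReal_mul, Complex.ofReal_cpow (by positivity)]
  push_cast
  ring

/-- The denominator of the coefficient function of the two-loop diagram. -/
def triangleDen (D α₁ α₄ : ℂ) : ℂ :=
  (D - α₁ - α₄ - 2) * oneLoopDen D 1 1 * oneLoopDen D (1 + α₁) α₄ *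
    oneLoopDen D (1 + α₁) (2 + α₄ - D / 2) * oneLoopDen D α₁ (1 + α₄) *
    oneLoopDen D (2 + α₁ - D / 2) (1 + α₄)

/-- The numerator of the coefficient function of the two-loop diagram. -/
def triangleNum (D α₁ α₄ : ℂ) : ℂ :=
  oneLoopNum D 1 1 *
    (α₁ * oneLoopNum D (1 + α₁) α₄ * oneLoopDen D (1 + α₁) (2 + α₄ - D / 2) *
        oneLoopDen D α₁ (1 + α₄) * oneLoopDen D (2 + α₁ - D / 2) (1 + α₄)
      - α₁ * oneLoopNum D (1 + α₁) (2 + α₄ - D / 2) * oneLoopDen D (1 + α₁) α₄ *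
        oneLoopDen D α₁ (1 + α₄) * oneLoopDen D (2 + α₁ - D / 2) (1 + α₄)
      + α₄ * oneLoopNum D α₁ (1 + α₄) * oneLoopDen D (1 + α₁) α₄ *
        oneLoopDen D (1 + α₁) (2 + α₄ - D / 2) * oneLoopDen D (2 + α₁ - D / 2) (1 + α₄)
      - α₄ * oneLoopNum D (2 + α₁ - D / 2) (1 + α₄) * oneLoopDen D (1 + α₁) α₄ *
        oneLoopDen D (1 + α₁) (2 + α₄ - D / 2) * oneLoopDen D α₁ (1 + α₄))

/-- The real triangle relation multiplied by all five one-loop denominators, which removes every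
possible pole. -/
theorem triangleDen_mul_integral {p : ℝ} (hp : 0 < p) {v : ℝ × ℝ × ℝ} (hv : v ∈ trianglePatch) :
    triangleDen v.1 v.2.1 v.2.2 *
        ((∫ x in twoLoopRegion, triangleDensity v.1 p v.2.1 v.2.2 x : ℝ) : ℂ) =
      planeConst v.1 * spaceConst v.1 * ((p ^ 2 : ℝ) : ℂ) ^ ((v.1 : ℂ) - v.2.1 - v.2.2 - 3) *
        triangleNum v.1 v.2.1 v.2.2 := by
  obtain ⟨D, α₁, α₄⟩ := v
  have h := congrArg (fun r : ℝ => (r : ℂ)) (integral_triangleDensity hp hv).2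
  obtain ⟨h1, h2, h3, h4, h5, h6, h7, h8⟩ := hv
  simp only at h h1 h2 h3 h4 h5 h6 h7 h8 ⊢
  have g0 := oneLoopDen_mul_realOneLoopG (D := D) (α := 1) (β := 1) (by linarith) (by linarith)
    (by linarith)
  have g1 := oneLoopDen_mul_realOneLoopG (D := D) (α := 1 + α₁) (β := α₄) (by linarith)
    (by linarith) (by linarith)
  have g2 := oneLoopDen_mul_realOneLoopG (D := D) (α := 1 + α₁) (β := 2 + α₄ - D / 2)
    (by linarith) (by linarith) (by linarith)
  have g3 := oneLoopDen_mul_realOneLoopG (D := D) (α := α₁) (β := 1 + α₄) (by linarith)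
    (by linarith) (by linarith)
  have g4 := oneLoopDen_mul_realOneLoopG (D := D) (α := 2 + α₁ - D / 2) (β := 1 + α₄)
    (by linarith) (by linarith) (by linarith)
  simp only [Complex.ofReal_mul, Complex.ofReal_add, Complex.ofReal_sub, Complex.ofReal_div,
    Complex.ofReal_one, Complex.ofReal_ofNat,
    Complex.ofReal_cpow (show 0 ≤ p ^ 2 by positivity)] at h g0 g1 g2 g3 g4
  rw [triangleDen, triangleNum, ← g0, ← g1, ← g2, ← g3, ← g4]
  linear_combination (oneLoopDen D 1 1 * oneLoopDen D (1 + α₁) α₄ *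
    oneLoopDen D (1 + α₁) (2 + α₄ - D / 2) * oneLoopDen D α₁ (1 + α₄) *
    oneLoopDen D (2 + α₁ - D / 2) (1 + α₄)) * h

theorem hasContinuation_triangle {p : ℝ} (hp : 0 < p) {D α₁ α₄ : ℂ}
    (hden : triangleDen D α₁ α₄ ≠ 0) :
    HasContinuation (triangleDomain p) (convTriangleJ p) (D, α₁, α₄)
      (((p ^ 2 : ℝ) : ℂ) ^ (D - α₁ - α₄ - 3) * ((4 * Real.pi : ℝ) : ℂ) ^ (-D) *
        triangleNum D α₁ α₄ / triangleDen D α₁ α₄) := by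
  have hnum : ∀ {f g : ℂ × ℂ × ℂ → ℂ}, Differentiable ℂ f → Differentiable ℂ g →
      Differentiable ℂ fun z : ℂ × ℂ × ℂ => oneLoopNum z.1 (f z) (g z) :=
    fun hf hg => differentiable_oneLoopNum differentiable_fst hf hg
  have hdn : ∀ {f g : ℂ × ℂ × ℂ → ℂ}, Differentiable ℂ f → Differentiable ℂ g →
      Differentiable ℂ fun z : ℂ × ℂ × ℂ => oneLoopDen z.1 (f z) (g z) :=
    fun hf hg => differentiable_oneLoopDen differentiable_fst hf hg
  have d1 : Differentiable ℂ fun z : ℂ × ℂ × ℂ => oneLoopDen z.1 (1 + z.2.1) z.2.2 :=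
    hdn (by fun_prop) (by fun_prop)
  have d2 : Differentiable ℂ fun z : ℂ × ℂ × ℂ =>
      oneLoopDen z.1 (1 + z.2.1) (2 + z.2.2 - z.1 / 2) :=
    hdn (by fun_prop) (by fun_prop)
  have d3 : Differentiable ℂ fun z : ℂ × ℂ × ℂ => oneLoopDen z.1 z.2.1 (1 + z.2.2) :=
    hdn (by fun_prop) (by fun_prop)
  have d4 : Differentiable ℂ fun z : ℂ × ℂ × ℂ =>
      oneLoopDen z.1 (2 + z.2.1 - z.1 / 2) (1 + z.2.2) :=
    hdn (by fun_prop) (by fun_prop)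
  have n1 : Differentiable ℂ fun z : ℂ × ℂ × ℂ => oneLoopNum z.1 (1 + z.2.1) z.2.2 :=
    hnum (by fun_prop) (by fun_prop)
  have n2 : Differentiable ℂ fun z : ℂ × ℂ × ℂ =>
      oneLoopNum z.1 (1 + z.2.1) (2 + z.2.2 - z.1 / 2) :=
    hnum (by fun_prop) (by fun_prop)
  have n3 : Differentiable ℂ fun z : ℂ × ℂ × ℂ => oneLoopNum z.1 z.2.1 (1 + z.2.2) :=
    hnum (by fun_prop) (by fun_prop)
  have n4 : Differentiable ℂ fun z : ℂ × ℂ × ℂ =>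
      oneLoopNum z.1 (2 + z.2.1 - z.1 / 2) (1 + z.2.2) :=
    hnum (by fun_prop) (by fun_prop)
  have d0 : Differentiable ℂ fun z : ℂ × ℂ × ℂ => oneLoopDen z.1 1 1 :=
    hdn (by fun_prop) (by fun_prop)
  have n0 : Differentiable ℂ fun z : ℂ × ℂ × ℂ => oneLoopNum z.1 1 1 :=
    hnum (by fun_prop) (by fun_prop)
  have hN : Differentiable ℂ fun z : ℂ × ℂ × ℂ => triangleNum z.1 z.2.1 z.2.2 := by
    unfold triangleNum; fun_prop
  have hB : Differentiable ℂ fun z : ℂ × ℂ × ℂ => triangleDen z.1 z.2.1 z.2.2 := by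
    unfold triangleDen; fun_prop
  have hA : Differentiable ℂ fun z : ℂ × ℂ × ℂ =>
      ((p ^ 2 : ℝ) : ℂ) ^ (z.1 - z.2.1 - z.2.2 - 3) * ((4 * Real.pi : ℝ) : ℂ) ^ (-z.1) *
        triangleNum z.1 z.2.1 z.2.2 :=
    ((differentiable_ofReal_cpow (by positivity) (by fun_prop)).mul
      (differentiable_ofReal_cpow (by positivity) (by fun_prop))).mul hN
  have hs1 : Differentiable ℂ fun z : ℂ × ℂ × ℂ => sphereArea (z.1 - 1) :=
    differentiable_sphereArea (by fun_prop)
  have hs2 : Differentiable ℂ fun z : ℂ × ℂ × ℂ => sphereArea (z.1 - 2) :=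
    differentiable_sphereArea (by fun_prop)
  have hc : Differentiable ℂ fun z : ℂ × ℂ × ℂ => sphereArea (z.1 - 1) * sphereArea (z.1 - 2) /
      (((2 * Real.pi : ℝ) : ℂ) ^ z.1) ^ 2 := by
    simp only [pow_two, ← div_div]
    exact differentiable_div_ofReal_cpow (by positivity)
      (differentiable_div_ofReal_cpow (by positivity) (hs1.mul hs2) (by fun_prop)) (by fun_prop)
  refine ⟨_, _, hA, hB, fun z hz => ?_, hden, rfl⟩
  rw [triangleDomain_eq] at hz
  rw [convTriangleJ_eq, ← mul_assoc]
  refine mul_integral_expFamily_eq (measurable_triangleOffset p) (measurable_triangleExponents p)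
    hA (hB.mul hc) isOpen_trianglePatch trianglePatch_nonempty
    (fun v hv => (integral_triangleFamily hp hv).1) (fun v hv => ?_) hz
  rw [(integral_triangleFamily hp hv).2]
  have h := triangleDen_mul_integral hp hv
  simp only [Pi.mul_apply, ofReals]
  rw [← twoLoop_const hv.1]
  linear_combination (sphereArea (v.1 - 1) * sphereArea (v.1 - 2) /
    (((2 * Real.pi : ℝ) : ℂ) ^ (v.1 : ℂ)) ^ 2) * h

/-! ### The diagrams and their coefficient functions -/

/-- Uniqueness makes the value independent of the choice in `continuation`. -/
theorem HasContinuation.continuation_eq {E : Type*} [NormedAddCommGroup E] [NormedSpace ℂ E]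
    {U : Set E} {f : E → ℂ} {z : E} {w : ℂ} (hU : (interior U).Nonempty)
    (h : HasContinuation U f z w) : continuation U f z = w := by
  have hr : RegularAt U f z := ⟨w, h⟩
  rw [continuation, dif_pos hr]
  exact HasContinuation.unique hU hr.choose_spec h

theorem oneLoopRegular {p : ℝ} (hp : 0 < p) {D α β : ℂ} (hden : oneLoopDen D α β ≠ 0) :
    OneLoopRegular D p α β :=
  ⟨_, hasContinuation_oneLoop hp hden⟩

theorem oneLoopG_eq {D α β : ℂ} (hden : oneLoopDen D α β ≠ 0) :
    oneLoopG D α β = oneLoopNum D α β / oneLoopDen D α β := by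
  have h4 : ((4 * Real.pi : ℝ) : ℂ) ^ (D / 2) ≠ 0 := ofReal_cpow_ne_zero (by positivity) _
  rw [oneLoopG, oneLoopJ, (hasContinuation_oneLoop one_pos hden).continuation_eq
    (oneLoopDomain_interior_nonempty one_pos), Complex.cpow_neg, one_pow, Complex.ofReal_one,
    Complex.one_cpow]
  field_simp

theorem triangleJ_eq {p : ℝ} (hp : 0 < p) {D α₁ α₄ : ℂ} (hden : triangleDen D α₁ α₄ ≠ 0) :
    triangleJ D p α₁ α₄ = ((p ^ 2 : ℝ) : ℂ) ^ (D - α₁ - α₄ - 3) *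
      ((4 * Real.pi : ℝ) : ℂ) ^ (-D) * triangleNum D α₁ α₄ / triangleDen D α₁ α₄ :=
  (hasContinuation_triangle hp hden).continuation_eq (triangleDomain_interior_nonempty hp)

theorem triangleG_eq {D α₁ α₄ : ℂ} (hden : triangleDen D α₁ α₄ ≠ 0) :
    triangleG D α₁ α₄ = triangleNum D α₁ α₄ / triangleDen D α₁ α₄ := by
  have h4 : ((4 * Real.pi : ℝ) : ℂ) ^ D ≠ 0 := ofReal_cpow_ne_zero (by positivity) _
  rw [triangleG, triangleJ_eq one_pos hden, Complex.cpow_neg, one_pow, Complex.ofReal_one,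
    Complex.one_cpow]
  field_simp

end DimReg

end

/-! ### Translation of the parameter conditions and conclusion -/

theorem mainTheorem4 (D α₁ α₄ : ℂ)
    (hD : ∀ n : ℤ, D ≠ 2 * n)
    (h₁ : ∀ n : ℕ, α₁ ≠ D / 2 - 1 + n) (h₁' : ∀ n : ℕ, α₁ ≠ D - 2 + n)
    (h₄ : ∀ n : ℕ, α₄ ≠ D / 2 - 1 + n) (h₄' : ∀ n : ℕ, α₄ ≠ D - 2 + n)
    (h₁₄ : ∀ n : ℕ, α₁ + α₄ ≠ D / 2 - 1 - n) (h₁₄' : ∀ n : ℕ, α₁ + α₄ ≠ D - 3 - n)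
    (hne : D - α₁ - α₄ - 2 ≠ 0) :
    (∀ p : ℝ, 0 < p →
      DimReg.TriangleRegular D p α₁ α₄ ∧
      DimReg.OneLoopRegular D p 1 1 ∧
      DimReg.OneLoopRegular D p (1 + α₁) α₄ ∧
      DimReg.OneLoopRegular D p (1 + α₁) (2 + α₄ - D / 2) ∧
      DimReg.OneLoopRegular D p α₁ (1 + α₄) ∧
      DimReg.OneLoopRegular D p (2 + α₁ - D / 2) (1 + α₄)) ∧
    (∀ p : ℝ, 0 < p →
      DimReg.triangleJ D p α₁ α₄ =
        ((p ^ 2 : ℝ) : ℂ) ^ (D - α₁ - α₄ - 3) / ((4 * Real.pi : ℝ) : ℂ) ^ D *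
          DimReg.triangleG D α₁ α₄) ∧
    DimReg.triangleG D α₁ α₄ =
      DimReg.oneLoopG D 1 1 / (D - α₁ - α₄ - 2) *
        (α₁ * DimReg.oneLoopG D (1 + α₁) α₄
          - α₁ * DimReg.oneLoopG D (1 + α₁) (2 + α₄ - D / 2)
          + α₄ * DimReg.oneLoopG D α₁ (1 + α₄)
          - α₄ * DimReg.oneLoopG D (2 + α₁ - D / 2) (1 + α₄)) := by
  -- Poles of `Γ(D/2 - 1)` and `Γ(2 - D/2)` lie at the even integers `D ≤ 2` and `D ≥ 4`
  -- respectively.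
  have hd : ∀ n : ℕ, D / 2 - 1 ≠ -n := fun n h => hD (1 - n) (by
    push_cast; linear_combination 2 * h)
  have hd' : ∀ n : ℕ, 1 + 1 - D / 2 ≠ -n := fun n h => hD (2 + n) (by
    push_cast; linear_combination -2 * h)
  have k1 : ∀ n : ℕ, D / 2 - (1 + α₁) ≠ -n := fun n h => h₁ n (by linear_combination -h)
  -- The poles of `Γ(D/2 - α₁)` are those of `Γ(D/2 - 1 - α₁)` without the first, hence the shift to
  -- `n + 1`.
  have k1' : ∀ n : ℕ, D / 2 - α₁ ≠ -n := fun n h => h₁ (n + 1) (by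
    push_cast; linear_combination -h)
  have k4 : ∀ n : ℕ, D / 2 - (1 + α₄) ≠ -n := fun n h => h₄ n (by linear_combination -h)
  have k4' : ∀ n : ℕ, D / 2 - α₄ ≠ -n := fun n h => h₄ (n + 1) (by
    push_cast; linear_combination -h)
  have d0 : DimReg.oneLoopDen D 1 1 ≠ 0 := DimReg.oneLoopDen_ne_zero hd hd hd'
  have d1 : DimReg.oneLoopDen D (1 + α₁) α₄ ≠ 0 := DimReg.oneLoopDen_ne_zero k1 k4'
    fun n h => h₁₄ n (by linear_combination h)
  -- With the shifted index the Gamma arguments are `D - 2 - α₄` and `α₁ + α₄ + 3 - D`, whence the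
  -- conditions involving `D - 2 + n` and `D - 3 - n`.
  have d2 : DimReg.oneLoopDen D (1 + α₁) (2 + α₄ - D / 2) ≠ 0 := DimReg.oneLoopDen_ne_zero k1
    (fun n h => h₄' n (by linear_combination -h)) fun n h => h₁₄' n (by linear_combination h)
  have d3 : DimReg.oneLoopDen D α₁ (1 + α₄) ≠ 0 := DimReg.oneLoopDen_ne_zero k1' k4
    fun n h => h₁₄ n (by linear_combination h)
  have d4 : DimReg.oneLoopDen D (2 + α₁ - D / 2) (1 + α₄) ≠ 0 := DimReg.oneLoopDen_ne_zero
    (fun n h => h₁' n (by linear_combination -h)) k4 fun n h => h₁₄' n (by linear_combination h)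
  have dt : DimReg.triangleDen D α₁ α₄ ≠ 0 :=
    mul_ne_zero (mul_ne_zero (mul_ne_zero (mul_ne_zero (mul_ne_zero hne d0) d1) d2) d3) d4
  refine ⟨fun p hp => ⟨⟨_, DimReg.hasContinuation_triangle hp dt⟩, DimReg.oneLoopRegular hp d0,
    DimReg.oneLoopRegular hp d1, DimReg.oneLoopRegular hp d2, DimReg.oneLoopRegular hp d3,
    DimReg.oneLoopRegular hp d4⟩, fun p hp => ?_, ?_⟩
  · rw [DimReg.triangleJ_eq hp dt, DimReg.triangleG_eq dt, Complex.cpow_neg]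
    ring
  · rw [DimReg.triangleG_eq dt, DimReg.oneLoopG_eq d0, DimReg.oneLoopG_eq d1,
      DimReg.oneLoopG_eq d2, DimReg.oneLoopG_eq d3, DimReg.oneLoopG_eq d4, DimReg.triangleNum,
      DimReg.triangleDen]
    -- Only nonvanishing of the denominators matters now, so they become atoms and the claim is an
    -- identity of rational functions.
    generalize DimReg.oneLoopDen D 1 1 = x0 at *
    generalize DimReg.oneLoopDen D (1 + α₁) α₄ = x1 at *
    generalize DimReg.oneLoopDen D (1 + α₁) (2 + α₄ - D / 2) = x2 at *
    generalize DimReg.oneLoopDen D α₁ (1 + α₄) = x3 at *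
    generalize DimReg.oneLoopDen D (2 + α₁ - D / 2) (1 + α₄) = x4 at *
    generalize DimReg.oneLoopNum D (1 + α₁) (2 + α₄ - D / 2) = y2
    generalize DimReg.oneLoopNum D (2 + α₁ - D / 2) (1 + α₄) = y4
    field_simp
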